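/- Let $k$ be a field and let $A$ and $B$ be nonzero finite dimensional $k$-algebras (associative, with unit); write $\otimes$ for $\otimes_k$. For a finite dimensional $k$-algebra $\Gamma$, all modules are finitely generated left modules unless stated otherwise. A $\Gamma$-module $G$ is called Gorenstein projective if there is an exact complex $P^\bullet=(\cdots\to P^{i}\xrightarrow{d^i}P^{i+1}\xrightarrow{d^{i+1}}P^{i+2}\to\cdots)$, $i\in\mathbb{Z}$, of finitely generated projective $\Gamma$-modules such that $\operatorname{Hom}_\Gamma(P^\bullet,\Gamma)$ is also exact and $G\cong\operatorname{Ker} d^1$. The algebra $\Gamma$ is CM-free if the Gorenstein projective $\Gamma$-modules are exactly the projective ones; $\Gamma$ is Gorenstein if it has finite injective dimension both as a left and as a right $\Gamma$-module; and $k$ is a splitting field for $\Gamma$ if every simple $\Gamma$-module $S$ satisfies $\operatorname{End}_\Gamma(S)=k$. (1) If $A\otimes B$ is CM-free, then both $A$ and $B$ are CM-free. (2) Assume that $k$ is a splitting field for $A$ or for $B$, and that $A$ or $B$ is Gorenstein. Then $A\otimes B$ is CM-free if and only if both $A$ and $B$ are CM-free. -/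

import Mathlib

open scoped TensorProduct

namespace FinDimAlg

universe u v

/-- A module `G` over a ring `A` is (finitely generated) Gorenstein projective if it admits a
complete projective resolution: an exact complex
`⋯ ⟶ P i ⟶ P (i + 1) ⟶ P (i + 2) ⟶ ⋯`, indexed by `ℤ`, of finitely generated projective
(left) `A`-modules such that the complex `Hom_A(P, A)` is exact as well and `G ≅ Ker (d 1)`.
Here `A` and the modules live in one universe; up to isomorphism this is no restriction for
finitely generated modules. -/
def IsGorensteinProjective (A : Type u) [Ring A] (G : Type u) [AddCommGroup G] [Module A G] :
    Prop :=
  ∃ (P : ℤ → ModuleCat.{u} A) (d : ∀ i : ℤ, P i →ₗ[A] P (i + 1)),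
    (∀ i, Module.Finite A (P i)) ∧
    (∀ i, Module.Projective A (P i)) ∧
    (∀ i, Function.Exact (d i) (d (i + 1))) ∧
    (∀ i, Function.Exact
      (fun g : P (i + 1 + 1) →ₗ[A] A => g ∘ₗ d (i + 1))
      (fun f : P (i + 1) →ₗ[A] A => f ∘ₗ d i)) ∧
    Nonempty (G ≃ₗ[A] LinearMap.ker (d 1))

/-- `A` is CM-free if, among finitely generated left `A`-modules, the Gorenstein projective ones
are exactly the projective ones. -/
def IsCMFree (A : Type u) [Ring A] : Prop :=
  ∀ (G : Type u) [AddCommGroup G] [Module A G] [Module.Finite A G],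
    IsGorensteinProjective A G ↔ Module.Projective A G

/-- `A` is Gorenstein if it has finite injective dimension both as a left module and as a right
module over itself. Right `A`-modules are left modules over the opposite ring `Aᵐᵒᵖ`. -/
def IsGorenstein (A : Type u) [Ring A] : Prop :=
  CategoryTheory.injectiveDimension (ModuleCat.of A A) < ⊤ ∧
    CategoryTheory.injectiveDimension (ModuleCat.of Aᵐᵒᵖ A) < ⊤

/-- `k` is a splitting field for the `k`-algebra `A` if every simple `A`-module has endomorphism
algebra `k`, that is, its only `A`-endomorphisms are the scalars from `k`. The `k`-module
structure on `S` is the one induced from `A`. -/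
def IsSplittingFieldFor (k : Type v) (A : Type u) [Field k] [Ring A] [Algebra k A] : Prop :=
  ∀ (S : Type u) [AddCommGroup S] [Module A S] [Module k S] [IsScalarTower k A S],
    IsSimpleModule A S → Function.Bijective (algebraMap k (Module.End A S))

end FinDimAlg

/-! For (1), let `P` be a complete projective resolution over `A`. Then `P ⊗ B` is one over `A ⊗ B`,
because induction is adjoint to restriction and `A ⊗ B` is a finite free `A`-module. Its kernels are
projective over `A ⊗ B`, hence over `A`, and a linear form on `B` with value 1 at 1 makes the
kernels of `P` direct summands of them. The case of `B` follows by swapping the factors.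

For (2), let `A` be Gorenstein and `P` a complete resolution over `A ⊗ B`. A kernel `K` of `P` is
projective as soon as `Hom(P, K)` is exact (`projective_ker_of_homExact`). Exactness of `Hom(P, M)`
passes to extensions in `M`, so simple `M` suffice. By density and the splitting hypothesis, a
simple `M` is `Hom_k(N, V)` for a right `B`-module `N` and an `A`-module `V`, or `Hom_k(U, W)` for a
right `A`-module `U` and a `B`-module `W`; transposition reduces the second form to the first.

Now `Hom(P, Hom_k(N, V)) = Hom_A(N ⊗_B P, V)`, and the two CM-free hypotheses enter in turn. Over
`B`: `Hom_B(P, B) = Hom(P, Hom_k(A, B))` is exact, since a finite injective coresolution of the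
right module `A` reduces it to `Hom_k(DA, B) ≅ A ⊗ B`, where `D` is the `k`-dual. So `P` is a
complete resolution over `B`, has projective kernels and is contractible there. Over `A`: `N ⊗_B P`
is therefore an exact complex of projectives, `Hom_A(-, A)` keeps it exact because `A` has finite
injective dimension on the left, and so it is contractible too. -/

open scoped TensorProduct

namespace FinDimAlg

universe u v w w₁ w₂ w₃

/-! ### Exactness of `Hom(P, M)` as a property of `M`. -/

section HomExact

variable {R : Type u} [Ring R] {P : ℤ → Type w} [∀ i, AddCommGroup (P i)] [∀ i, Module R (P i)]
  (d : ∀ i, P i →ₗ[R] P (i + 1))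

/-- The complex `Hom_R(P, M)` is exact: every map `P (i + 1) → M` that vanishes on boundaries
factors through the differential. -/
def HomExact (M : Type w₁) [AddCommGroup M] [Module R M] : Prop :=
  ∀ i (f : P (i + 1) →ₗ[R] M), f ∘ₗ d i = 0 → ∃ g : P (i + 1 + 1) →ₗ[R] M, g ∘ₗ d (i + 1) = f

variable {d} {M : Type w₁} [AddCommGroup M] [Module R M] {N : Type w₂} [AddCommGroup N] [Module R N]
  {L : Type w₃} [AddCommGroup L] [Module R L]

theorem HomExact.of_retract (h : HomExact d N) (s : M →ₗ[R] N) (r : N →ₗ[R] M)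
    (hrs : r ∘ₗ s = LinearMap.id) : HomExact d M := by
  intro i f hf
  obtain ⟨g, hg⟩ := h i (s ∘ₗ f) (by rw [LinearMap.comp_assoc, hf, LinearMap.comp_zero])
  exact ⟨r ∘ₗ g, by rw [LinearMap.comp_assoc, hg, ← LinearMap.comp_assoc, hrs, LinearMap.id_comp]⟩

theorem HomExact.of_equiv (h : HomExact d N) (e : M ≃ₗ[R] N) : HomExact d M :=
  h.of_retract e.toLinearMap e.symm.toLinearMap (by ext; simp)

theorem HomExact.pi {ι : Type*} {M : ι → Type*} [∀ j, AddCommGroup (M j)] [∀ j, Module R (M j)]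
    (h : ∀ j, HomExact d (M j)) : HomExact d (∀ j, M j) := by
  intro i f hf
  choose g hg using fun j ↦ h j i (LinearMap.proj j ∘ₗ f)
    (by rw [LinearMap.comp_assoc, hf, LinearMap.comp_zero])
  exact ⟨LinearMap.pi g, by ext x j; exact LinearMap.congr_fun (hg j) x⟩

theorem homExact_of_subsingleton [Subsingleton M] : HomExact d M :=
  fun _ _ _ ↦ ⟨0, by ext; exact Subsingleton.elim _ _⟩

theorem exists_comp_eq_of_injective {X : Type*} [AddCommGroup X] [Module R X] {ι : L →ₗ[R] M}
    {π : M →ₗ[R] N} (hι : Function.Injective ι) (hex : Function.Exact ι π) (f : X →ₗ[R] M)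
    (hf : π ∘ₗ f = 0) : ∃ g : X →ₗ[R] L, ι ∘ₗ g = f := by
  have hr : ∀ x, f x ∈ LinearMap.range ι := fun x ↦ (hex _).1 (LinearMap.congr_fun hf x)
  refine ⟨(LinearEquiv.ofInjective ι hι).symm.toLinearMap ∘ₗ f.codRestrict _ hr, ?_⟩
  ext x
  exact congrArg Subtype.val
    ((LinearEquiv.ofInjective ι hι).apply_symm_apply (f.codRestrict _ hr x))

variable [∀ i, Module.Projective R (P i)] (hd : ∀ i, Function.Exact (d i) (d (i + 1)))
  {ι : L →ₗ[R] M} {π : M →ₗ[R] N} (hι : Function.Injective ι) (hex : Function.Exact ι π)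
  (hπ : Function.Surjective π)

include hd hι hex hπ

/-- As each `P i` is projective, a short exact sequence of coefficients gives a short exact sequence
of Hom complexes; this and the next two results are the two-out-of-three property for acyclicity, by
diagram chase. -/
theorem HomExact.of_left_of_right (hL : HomExact d L) (hN : HomExact d N) : HomExact d M := by
  intro i f hf
  obtain ⟨g, hg⟩ := hN i (π ∘ₗ f) (by rw [LinearMap.comp_assoc, hf, LinearMap.comp_zero])
  obtain ⟨g', hg'⟩ := Module.projective_lifting_property π g hπ
  obtain ⟨h, hh⟩ := exists_comp_eq_of_injective hι hex (f - g' ∘ₗ d (i + 1)) (by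
    rw [LinearMap.comp_sub, ← LinearMap.comp_assoc, hg', hg, sub_self])
  obtain ⟨h', hh'⟩ := hL i h (by
    ext x
    apply hι
    have h1 := LinearMap.congr_fun hh (d i x)
    have h2 : f (d i x) = 0 := LinearMap.congr_fun hf x
    simpa [h2, (hd i).apply_apply_eq_zero x] using h1)
  refine ⟨g' + ι ∘ₗ h', ?_⟩
  rw [LinearMap.add_comp, LinearMap.comp_assoc, hh', hh]
  abel

theorem HomExact.of_middle_of_right (hM : HomExact d M) (hN : HomExact d N) : HomExact d L := by
  intro i f hf
  obtain ⟨g, hg⟩ := hM i (ι ∘ₗ f) (by rw [LinearMap.comp_assoc, hf, LinearMap.comp_zero])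
  have hπι : π ∘ₗ ι = 0 := hex.linearMap_comp_eq_zero
  obtain ⟨h, hh⟩ := hN (i + 1) (π ∘ₗ g) (by
    rw [LinearMap.comp_assoc, hg, ← LinearMap.comp_assoc, hπι, LinearMap.zero_comp])
  obtain ⟨h', hh'⟩ := Module.projective_lifting_property π h hπ
  obtain ⟨q, hq⟩ := exists_comp_eq_of_injective hι hex (g - h' ∘ₗ d (i + 1 + 1)) (by
    rw [LinearMap.comp_sub, ← LinearMap.comp_assoc, hh', hh, sub_self])
  refine ⟨q, ?_⟩
  ext x
  apply hι
  have h1 := LinearMap.congr_fun hq (d (i + 1) x)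
  have h2 : g (d (i + 1) x) = ι (f x) := LinearMap.congr_fun hg x
  simpa [h2, (hd (i + 1)).apply_apply_eq_zero x] using h1

theorem HomExact.of_left_of_middle (hL : HomExact d L) (hM : HomExact d M) : HomExact d N := by
  intro i f hf
  -- The connecting map shifts the degree: exactness for `N` at `i` uses exactness for `L` one index
  -- lower.
  obtain ⟨j, rfl⟩ : ∃ j, i = j + 1 := ⟨i - 1, by ring⟩
  obtain ⟨f', hf'⟩ := Module.projective_lifting_property π f hπ
  obtain ⟨h, hh⟩ := exists_comp_eq_of_injective hι hex (f' ∘ₗ d (j + 1)) (by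
    rw [← LinearMap.comp_assoc, hf', hf])
  obtain ⟨h', hh'⟩ := hL j h (by
    ext x
    apply hι
    have h1 := LinearMap.congr_fun hh (d j x)
    simpa [(hd j).apply_apply_eq_zero x] using h1)
  obtain ⟨g, hg⟩ := hM (j + 1) (f' - ι ∘ₗ h') (by
    rw [LinearMap.sub_comp, LinearMap.comp_assoc, hh', hh, sub_self])
  refine ⟨π ∘ₗ g, ?_⟩
  rw [LinearMap.comp_assoc, hg, LinearMap.comp_sub, hf', ← LinearMap.comp_assoc,
    hex.linearMap_comp_eq_zero, LinearMap.zero_comp, sub_zero]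

end HomExact

/-! ### Projective kernels, contractibility and injective dimension. -/

section Kernels

variable {R : Type u} [Ring R] {P : ℤ → Type w} [∀ i, AddCommGroup (P i)] [∀ i, Module R (P i)]
  {d : ∀ i, P i →ₗ[R] P (i + 1)} (hd : ∀ i, Function.Exact (d i) (d (i + 1)))

include hd

theorem exists_factor_of_exact {M : Type*} [AddCommGroup M] [Module R M] (i : ℤ)
    (f : P (i + 1) →ₗ[R] M) (hf : f ∘ₗ d i = 0) :
    ∃ g : LinearMap.range (d (i + 1)) →ₗ[R] M, g ∘ₗ (d (i + 1)).rangeRestrict = f := by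
  have hk : LinearMap.ker (d (i + 1)) ≤ LinearMap.ker f := by
    intro x hx
    obtain ⟨y, rfl⟩ := (hd i x).1 hx
    exact LinearMap.congr_fun hf y
  refine ⟨(LinearMap.ker (d (i + 1))).liftQ f hk ∘ₗ
    (d (i + 1)).quotKerEquivRange.symm.toLinearMap, ?_⟩
  ext x
  have : (d (i + 1)).quotKerEquivRange.symm ((d (i + 1)).rangeRestrict x) =
      Submodule.Quotient.mk x := by
    rw [LinearEquiv.symm_apply_eq]
    rfl
  simp [this]

/-- Projective kernels split the complex, and a split exact complex stays exact under every additive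
functor. -/
theorem homExact_of_projective_ker (h : ∀ i, Module.Projective R (LinearMap.ker (d i)))
    (M : Type*) [AddCommGroup M] [Module R M] : HomExact d M := by
  intro i f hf
  obtain ⟨g, hg⟩ := exists_factor_of_exact hd i f hf
  have he : ∀ i, LinearMap.range (d i) = LinearMap.ker (d (i + 1)) :=
    fun i ↦ ((hd i).linearMap_ker_eq).symm
  have : Module.Projective R (LinearMap.range (d (i + 1 + 1))) := by rw [he]; exact h _
  obtain ⟨s, hs⟩ := Module.projective_lifting_property (d (i + 1 + 1)).rangeRestrict LinearMap.id
    (d (i + 1 + 1)).surjective_rangeRestrict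
  -- The projection onto the boundaries along the section `s`.
  let p : P (i + 1 + 1) →ₗ[R] P (i + 1 + 1) :=
    LinearMap.id - s ∘ₗ (d (i + 1 + 1)).rangeRestrict
  have hmem : ∀ x, p x ∈ LinearMap.range (d (i + 1)) := by
    intro x
    rw [he, LinearMap.mem_ker]
    have : d (i + 1 + 1) (s ((d (i + 1 + 1)).rangeRestrict x)) = d (i + 1 + 1) x :=
      congrArg Subtype.val (LinearMap.congr_fun hs ((d (i + 1 + 1)).rangeRestrict x))
    simp [p, this]
  refine ⟨g ∘ₗ LinearMap.codRestrict _ _ hmem, ?_⟩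
  rw [← hg, LinearMap.comp_assoc]
  congr 1
  ext x
  have : (d (i + 1 + 1)).rangeRestrict (d (i + 1) x) = 0 :=
    Subtype.ext ((hd (i + 1)).apply_apply_eq_zero x)
  simp [p, this]

/-- Testing against the kernel itself: the differential onto the kernel extends along its inclusion
into the next term, and the extension is a retraction of the inclusion. -/
theorem projective_ker_of_homExact [∀ i, Module.Projective R (P i)] (i : ℤ)
    (h : HomExact d (LinearMap.ker (d i))) : Module.Projective R (LinearMap.ker (d i)) := by
  obtain ⟨j, rfl⟩ : ∃ j, i = j + 1 + 1 := ⟨i - 2, by ring⟩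
  obtain ⟨g, hg⟩ := h j ((d (j + 1)).codRestrict _ fun x ↦ (hd (j + 1)).apply_apply_eq_zero x)
    (by ext x; exact (hd j).apply_apply_eq_zero x)
  refine Module.Projective.of_split (Submodule.subtype _) g ?_
  ext ⟨x, hx⟩
  obtain ⟨y, rfl⟩ := (hd (j + 1) x).1 hx
  exact congrArg Subtype.val (LinearMap.congr_fun hg y)

theorem homExact_of_baer {M : Type*} [AddCommGroup M] [Module R M] (hM : Module.Baer R M) :
    HomExact d M := by
  intro i f hf
  obtain ⟨g, hg⟩ := exists_factor_of_exact hd i f hf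
  obtain ⟨g', hg'⟩ := hM.extension_property (Submodule.subtype _) (Submodule.subtype_injective _) g
  refine ⟨g', ?_⟩
  rw [← hg, ← hg']
  rfl

open CategoryTheory in
-- Dimension shifting: embed `M` in an injective and pass to the cokernel, whose injective dimension
-- is smaller.
theorem homExact_of_hasInjectiveDimensionLT [∀ i, Module.Projective R (P i)] (n : ℕ) :
    ∀ (M : ModuleCat.{u} R), HasInjectiveDimensionLT M (n + 1) → HomExact d M := by
  induction n with
  | zero =>
    intro M hM
    have : Injective M := by rwa [injective_iff_hasInjectiveDimensionLT_one]
    have := Module.injective_module_of_injective_object R M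
    exact homExact_of_baer hd (Module.Baer.of_injective this)
  | succ n ih =>
    intro M hM
    let S := ShortComplex.mk (Injective.ι M) (Limits.cokernel.π (Injective.ι M)) (by simp)
    have hS : S.ShortExact :=
      { exact := S.exact_of_g_is_cokernel (Limits.cokernelIsCokernel _)
        mono_f := by dsimp [S]; infer_instance
        epi_g := by dsimp [S]; infer_instance }
    have h3 : HasInjectiveDimensionLT S.X₃ (n + 1) :=
      (hS.hasInjectiveDimensionLT_X₃_iff n (by dsimp [S]; infer_instance)).2 hM
    have h2 : Injective S.X₂ := by dsimp [S]; infer_instance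
    exact HomExact.of_middle_of_right hd (ι := S.f.hom) (π := S.g.hom)
      hS.moduleCat_injective_f
      ((ShortComplex.ShortExact.moduleCat_exact_iff_function_exact S).1 hS.exact)
      hS.moduleCat_surjective_g
      (homExact_of_baer hd (Module.Baer.of_injective
        (Module.injective_module_of_injective_object R S.X₂))) (ih _ h3)

end Kernels

/-! ### CM-free rings in terms of complete resolutions. -/

section CMFree

theorem exact_comp_iff_homExact {R : Type u} [Ring R] {P : ℤ → Type w} [∀ i, AddCommGroup (P i)]
    [∀ i, Module R (P i)] {d : ∀ i, P i →ₗ[R] P (i + 1)}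
    (hd : ∀ i, Function.Exact (d i) (d (i + 1))) (M : Type*) [AddCommGroup M] [Module R M] :
    (∀ i, Function.Exact (fun g : P (i + 1 + 1) →ₗ[R] M => g ∘ₗ d (i + 1))
      (fun f : P (i + 1) →ₗ[R] M => f ∘ₗ d i)) ↔ HomExact d M := by
  refine forall_congr' fun i ↦ forall_congr' fun f ↦ ⟨fun h ↦ h.1, fun h ↦ ⟨h, ?_⟩⟩
  rintro ⟨g, rfl⟩
  ext x
  simp [(hd i).apply_apply_eq_zero x]

section Reindex

variable {R : Type u} [Ring R] {P : ℤ → Type w} [∀ i, AddCommGroup (P i)] [∀ i, Module R (P i)]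
  (d : ∀ i, P i →ₗ[R] P (i + 1))

/-- The differential of a complex, with a free name for the index of its target. -/
def differentialTo (i j : ℤ) (h : i + 1 = j) : P i →ₗ[R] P j := h ▸ d i

variable {d}

theorem differentialTo_exact (hd : ∀ i, Function.Exact (d i) (d (i + 1))) (i j l : ℤ)
    (h : i + 1 = j) (h' : j + 1 = l) :
    Function.Exact (differentialTo d i j h) (differentialTo d j l h') := by
  subst h h'
  exact hd i

theorem HomExact.exists_factor_differentialTo {M : Type*} [AddCommGroup M] [Module R M]
    (hM : HomExact d M) (i j l : ℤ) (h : i + 1 = j) (h' : j + 1 = l) (f : P j →ₗ[R] M)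
    (hf : f ∘ₗ differentialTo d i j h = 0) :
    ∃ g : P l →ₗ[R] M, g ∘ₗ differentialTo d j l h' = f := by
  subst h h'
  exact hM i f hf

variable (d) in
theorem ker_differentialTo (i j : ℤ) (h : i + 1 = j) :
    LinearMap.ker (differentialTo d i j h) = LinearMap.ker (d i) := by
  subst h
  rfl

end Reindex

/-- A finitely generated module has a model in the universe of the ring. -/
theorem exists_small_model (R : Type u) [Ring R] (M : Type w) [AddCommGroup M] [Module R M]
    [Module.Finite R M] : ∃ Q : ModuleCat.{u} R, Nonempty (Q ≃ₗ[R] M) :=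
  let ⟨_, S, e⟩ := Module.Finite.exists_fin_quot_equiv R M
  ⟨ModuleCat.of R (_ ⧸ S), e⟩

/-- The definition speaks of the kernel at index 1 and of modules in the universe of the ring. A
shift by `c` and small models of the terms remove both restrictions. -/
theorem IsCMFree.projective_ker {R : Type u} [Ring R] (hR : IsCMFree R) {P : ℤ → Type w}
    [∀ i, AddCommGroup (P i)] [∀ i, Module R (P i)] [∀ i, Module.Finite R (P i)]
    [∀ i, Module.Projective R (P i)] {d : ∀ i, P i →ₗ[R] P (i + 1)}
    (hd : ∀ i, Function.Exact (d i) (d (i + 1))) (hdR : HomExact d R) (i : ℤ) :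
    Module.Projective R (LinearMap.ker (d i)) := by
  obtain ⟨c, rfl⟩ : ∃ c, i = c + 1 := ⟨i - 1, by ring⟩
  choose Q e using fun j ↦ exists_small_model R (P (c + j))
  let e (j : ℤ) := (e j).some
  let D (j : ℤ) := differentialTo d (c + j) (c + (j + 1)) (by ring)
  let d' (j : ℤ) : Q j →ₗ[R] Q (j + 1) := (e (j + 1)).symm.toLinearMap ∘ₗ D j ∘ₗ (e j).toLinearMap
  have hD (j : ℤ) (x : Q j) : d' j x = (e (j + 1)).symm (D j (e j x)) := rfl
  have hd' (j : ℤ) : Function.Exact (d' j) (d' (j + 1)) := by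
    intro y
    have := differentialTo_exact hd (c + j) (c + (j + 1)) (c + (j + 1 + 1)) (by ring) (by ring)
      (e (j + 1) y)
    rw [hD, LinearEquiv.map_eq_zero_iff]
    refine this.trans ⟨?_, ?_⟩
    · rintro ⟨x, hx⟩
      refine ⟨(e j).symm x, ?_⟩
      rw [hD, LinearEquiv.apply_symm_apply, LinearEquiv.symm_apply_eq]
      exact hx
    · rintro ⟨x, rfl⟩
      exact ⟨e j x, by rw [hD, LinearEquiv.apply_symm_apply]⟩
  have hdR' : HomExact d' R := by
    intro j f hf
    obtain ⟨g, hg⟩ := hdR.exists_factor_differentialTo (c + j) (c + (j + 1)) (c + (j + 1 + 1))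
      (by ring) (by ring) (f ∘ₗ (e (j + 1)).symm.toLinearMap) (by
        ext x
        have := LinearMap.congr_fun hf ((e j).symm x)
        simpa [hD] using this)
    refine ⟨g ∘ₗ (e (j + 1 + 1)).toLinearMap, ?_⟩
    ext x
    have := LinearMap.congr_fun hg (e (j + 1) x)
    simpa [hD] using this
  have hfin (j : ℤ) : Module.Finite R (Q j) := Module.Finite.equiv (e j).symm
  have hproj (j : ℤ) : Module.Projective R (Q j) := Module.Projective.of_equiv' (e j).symm
  have hfg : Module.Finite R (LinearMap.ker (d' 1)) := by
    have : LinearMap.ker (d' (0 + 1)) = LinearMap.range (d' 0) := (hd' 0).linearMap_ker_eq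
    change Module.Finite R (LinearMap.ker (d' (0 + 1)))
    rw [this]
    infer_instance
  have hG : IsGorensteinProjective R (LinearMap.ker (d' 1)) :=
    ⟨Q, d', hfin, hproj, hd', (exact_comp_iff_homExact hd' R).2 hdR', ⟨LinearEquiv.refl _ _⟩⟩
  have h1 := (hR _).1 hG
  have hmap : (LinearMap.ker (d' 1)).map (e 1).toLinearMap = LinearMap.ker (d (c + 1)) := by
    rw [← ker_differentialTo d (c + 1) (c + (1 + 1)) (by ring)]
    ext x
    rw [Submodule.mem_map_equiv, LinearMap.mem_ker, LinearMap.mem_ker, hD,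
      LinearEquiv.map_eq_zero_iff, LinearEquiv.apply_symm_apply]
  have h2 := Module.Projective.of_equiv' ((e 1).submoduleMap (LinearMap.ker (d' 1)))
  rwa [hmap] at h2

theorem isCMFree_of_projective_ker {R : Type u} [Ring R]
    (h : ∀ (P : ℤ → ModuleCat.{u} R) (d : ∀ i, P i →ₗ[R] P (i + 1)),
      (∀ i, Module.Finite R (P i)) → (∀ i, Module.Projective R (P i)) →
      (∀ i, Function.Exact (d i) (d (i + 1))) → HomExact d R →
      Module.Projective R (LinearMap.ker (d 1))) : IsCMFree R := by
  intro G _ _ _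
  constructor
  · rintro ⟨P, d, hfin, hproj, hd, hdR, ⟨e⟩⟩
    have := h P d hfin hproj hd ((exact_comp_iff_homExact hd R).1 hdR)
    exact Module.Projective.of_equiv' e.symm
  · intro hG
    -- The contractible complex with `G × G` in every degree and differential `(x, y) ↦ (0, x)`; its
    -- kernels are copies of `G`.
    let d : G × G →ₗ[R] G × G := LinearMap.inr R G G ∘ₗ LinearMap.fst R G G
    have hd : Function.Exact d d := by
      rintro ⟨x, y⟩
      simp only [d, LinearMap.coe_comp, Function.comp_apply, LinearMap.fst_apply,
        LinearMap.inr_apply, Set.mem_range, Prod.mk_eq_zero, true_and, Prod.mk.injEq, Prod.exists]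
      exact ⟨fun h ↦ ⟨y, 0, h.symm, rfl⟩, fun ⟨_, _, h, _⟩ ↦ h.symm⟩
    have hker : LinearMap.ker d = LinearMap.range (LinearMap.inr R G G) := by
      ext ⟨x, y⟩
      simp [d, Prod.ext_iff, eq_comm]
    refine ⟨fun _ ↦ ModuleCat.of R (G × G), fun _ ↦ d,
      fun _ ↦ inferInstanceAs (Module.Finite R (G × G)),
      fun _ ↦ inferInstanceAs (Module.Projective R (G × G)), fun _ ↦ hd, ?_,
      ⟨(LinearEquiv.ofInjective (LinearMap.inr R G G) LinearMap.inr_injective).trans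
        (LinearEquiv.ofEq _ _ hker.symm)⟩⟩
    refine (exact_comp_iff_homExact (P := fun _ ↦ G × G) (d := fun _ ↦ d) (fun _ ↦ hd) R).2 ?_
    have hp : Module.Projective R (LinearMap.ker d) := by
      rw [hker]
      exact Module.Projective.of_equiv'
        (LinearEquiv.ofInjective (LinearMap.inr R G G) LinearMap.inr_injective)
    exact homExact_of_projective_ker (P := fun _ ↦ G × G) (d := fun _ ↦ d) (fun _ ↦ hd)
      (fun _ ↦ hp) R

theorem IsCMFree.of_ringEquiv {R S : Type u} [Ring R] [Ring S] (e : R ≃+* S) (hR : IsCMFree R) :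
    IsCMFree S := by
  refine isCMFree_of_projective_ker fun P d hfin hproj hd hdS ↦ ?_
  let (M : Type u) [AddCommGroup M] [Module S M] : Module R M := Module.compHom M (e : R →+* S)
  let toR {M N : Type u} [AddCommGroup M] [Module S M] [AddCommGroup N] [Module S N]
      (f : M →ₗ[S] N) : M →ₗ[R] N := { f with map_smul' := fun r x ↦ f.map_smul (e r) x }
  have hsmul {M : Type u} [AddCommGroup M] [Module S M] (r : R) (x : M) : r • x = e r • x := rfl
  have := RingHomInvPair.of_ringEquiv e
  have := RingHomInvPair.of_ringEquiv_symm e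
  let eS (M : Type u) [AddCommGroup M] [Module S M] : M ≃ₛₗ[(e.symm : S →+* R)] M :=
    { AddEquiv.refl M with
      map_smul' := fun s x ↦ (congrArg (· • x) (e.apply_symm_apply s)).symm }
  have : RingHomSurjective (e.symm : S →+* R) := ⟨e.symm.surjective⟩
  have hfin' (i) : Module.Finite R (P i) := Module.Finite.of_surjective
    (eS (P i)).toLinearMap (eS (P i)).surjective
  have hproj' (i) : Module.Projective R (P i) := Module.Projective.of_equiv (eS (P i))
  have h := hR.projective_ker (P := fun i ↦ P i) (d := fun i ↦ toR (d i)) hd (by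
    intro i f hf
    let f' : P (i + 1) →ₗ[S] S :=
      { toFun := fun x ↦ e (f x)
        map_add' := by simp
        map_smul' := fun s x ↦ by
          have := f.map_smul (e.symm s) x
          rw [hsmul, e.apply_symm_apply] at this
          simp [this] }
    obtain ⟨g, hg⟩ := hdS i f' (by
      ext x
      have : f (d i x) = 0 := LinearMap.congr_fun hf x
      simp [f', this])
    refine ⟨{ toFun := fun x ↦ e.symm (g x), map_add' := by simp, map_smul' := fun r x ↦ ?_ }, ?_⟩
    · simp [hsmul]
    · ext x
      have : g (d (i + 1) x) = e (f x) := LinearMap.congr_fun hg x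
      change e.symm (g (d (i + 1) x)) = f x
      rw [this, e.symm_apply_apply]) 1
  let eK : LinearMap.ker (toR (d 1)) ≃ₛₗ[(e : R →+* S)] LinearMap.ker (d 1) :=
    { toFun := fun x ↦ ⟨x.1, x.2⟩
      invFun := fun x ↦ ⟨x.1, x.2⟩
      map_add' := fun _ _ ↦ rfl
      map_smul' := fun _ _ ↦ rfl
      left_inv := fun _ ↦ rfl
      right_inv := fun _ ↦ rfl }
  exact Module.Projective.of_equiv eK

end CMFree

/-! ### Induction from `A` to `A ⊗ B`, and part (1). -/

section Induced

variable {k : Type u} {A : Type v} {B : Type w} [Field k] [Ring A] [Algebra k A] [Ring B]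
  [Algebra k B] {G : Type w₁} [AddCommGroup G] [Module k G] [Module A G] [IsScalarTower k A G]
  {H : Type w₂} [AddCommGroup H] [Module k H] [Module A H] [IsScalarTower k A H]

variable (k A B G) in
/-- The `A ⊗ B`-module `G ⊗ B` induced from an `A`-module `G`. -/
@[reducible] noncomputable def inducedModule : Module (A ⊗[k] B) (G ⊗[k] B) :=
  Module.compHom (G ⊗[k] B)
    ((Module.endTensorEndAlgHom (R := k) (S := k) (A := k) (M := G) (N := B)).comp
      (Algebra.TensorProduct.map (Algebra.lsmul k k G) (Algebra.lsmul k k B))).toRingHom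

attribute [local instance] inducedModule

theorem induced_smul_tmul (a : A) (b c : B) (g : G) :
    (a ⊗ₜ[k] b) • (g ⊗ₜ[k] c) = (a • g) ⊗ₜ[k] (b * c) := rfl

instance induced_isScalarTower : IsScalarTower A (A ⊗[k] B) (G ⊗[k] B) := by
  constructor
  intro a x y
  induction x with
  | zero => simp
  | add x₁ x₂ h₁ h₂ => simp only [smul_add, add_smul, h₁, h₂]
  | tmul a' b =>
    induction y with
    | zero => simp
    | add y₁ y₂ h₁ h₂ => simp only [smul_add, h₁, h₂]
    | tmul g c =>
      rw [TensorProduct.smul_tmul', induced_smul_tmul, induced_smul_tmul,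
        TensorProduct.smul_tmul', smul_assoc]

variable (B) in
/-- The map of induced modules given by a map of `A`-modules. -/
noncomputable def inducedMap (f : G →ₗ[A] H) : G ⊗[k] B →ₗ[A ⊗[k] B] H ⊗[k] B :=
  { (f.restrictScalars k).rTensor B with
    map_smul' := fun x y ↦ by
      change (f.restrictScalars k).rTensor B (x • y) = x • (f.restrictScalars k).rTensor B y
      induction x with
      | zero => simp
      | add x₁ x₂ h₁ h₂ => simp only [map_add, add_smul, h₁, h₂]
      | tmul a b =>
        induction y with
        | zero => simp
        | add y₁ y₂ h₁ h₂ => simp only [smul_add, map_add, h₁, h₂]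
        | tmul g c => simp [induced_smul_tmul] }

@[simp] theorem inducedMap_tmul (f : G →ₗ[A] H) (g : G) (b : B) :
    inducedMap B f (g ⊗ₜ[k] b) = f g ⊗ₜ[k] b := rfl

variable {M : Type*} [AddCommGroup M] [Module k M] [Module A M] [Module (A ⊗[k] B) M]
  [IsScalarTower A (A ⊗[k] B) M] [IsScalarTower k (A ⊗[k] B) M] [IsScalarTower k A M]

/-- The `A ⊗ B`-linear extension of an `A`-linear map to the induced module. -/
noncomputable def inducedLift (f : G →ₗ[A] M) : G ⊗[k] B →ₗ[A ⊗[k] B] M :=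
  { TensorProduct.lift (LinearMap.mk₂ k (fun g (b : B) ↦ ((1 : A) ⊗ₜ[k] b) • f g)
      (by simp) (fun c g b ↦ by
        rw [LinearMap.map_smul_of_tower, smul_comm])
      (by simp [TensorProduct.tmul_add, add_smul])
      (by simp [TensorProduct.tmul_smul])) with
    map_smul' := fun x y ↦ by
      induction x with
      | zero => simp
      | add x₁ x₂ h₁ h₂ => simp only [add_smul, AddHom.toFun_eq_coe, map_add,
          RingHom.id_apply] at h₁ h₂ ⊢; simp only [h₁, h₂]
      | tmul a b =>
        induction y with
        | zero => simp
        | add y₁ y₂ h₁ h₂ => simp only [smul_add, AddHom.toFun_eq_coe, map_add,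
            RingHom.id_apply] at h₁ h₂ ⊢; simp only [h₁, h₂]
        | tmul g c =>
          have : a • f g = (a ⊗ₜ[k] (1 : B)) • f g := by
            rw [← one_smul (A ⊗[k] B) (f g), ← smul_assoc, smul_smul, mul_one,
              Algebra.TensorProduct.one_def, TensorProduct.smul_tmul', smul_eq_mul, mul_one]
          simp [induced_smul_tmul, this, smul_smul] }

theorem inducedLift_tmul (f : G →ₗ[A] M) (g : G) (b : B) :
    inducedLift f (g ⊗ₜ[k] b) = ((1 : A) ⊗ₜ[k] b) • f g := rfl

/-- The unit of the adjunction between induction and restriction. -/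
noncomputable def inducedUnit : G →ₗ[A] G ⊗[k] B where
  toFun g := g ⊗ₜ 1
  map_add' _ _ := TensorProduct.add_tmul ..
  map_smul' _ _ := rfl

theorem induced_hom_ext {N : Type*} [AddCommGroup N] [Module (A ⊗[k] B) N]
    {f g : G ⊗[k] B →ₗ[A ⊗[k] B] N} (h : ∀ x, f (x ⊗ₜ 1) = g (x ⊗ₜ 1)) : f = g := by
  ext x
  induction x with
  | zero => simp
  | add x y hx hy => simp [hx, hy]
  | tmul x b =>
    have : x ⊗ₜ[k] b = ((1 : A) ⊗ₜ[k] b) • x ⊗ₜ[k] (1 : B) := by simp [induced_smul_tmul]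
    rw [this, map_smul, map_smul, h]

/-- Induction is left adjoint to restriction, which preserves surjections. -/
instance projective_induced [Module.Projective A G] :
    Module.Projective (A ⊗[k] B) (G ⊗[k] B) := by
  refine Module.Projective.of_lifting_property'' fun f hf ↦ ?_
  obtain ⟨s, hs⟩ := Module.projective_lifting_property (f.restrictScalars A) inducedUnit hf
  refine ⟨inducedLift s, induced_hom_ext fun x ↦ ?_⟩
  have : f (s x) = x ⊗ₜ 1 := LinearMap.congr_fun hs x
  simp [inducedLift_tmul, this, ← Algebra.TensorProduct.one_def]

instance finite_induced [FiniteDimensional k A] [FiniteDimensional k B] [Module.Finite A G] :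
    Module.Finite (A ⊗[k] B) (G ⊗[k] B) := by
  have : Module.Finite k G := Module.Finite.trans A G
  have : IsScalarTower k (A ⊗[k] B) (G ⊗[k] B) := by
    refine ⟨fun c x y ↦ ?_⟩
    rw [← smul_one_smul A c x, smul_assoc, ← smul_one_smul A c (x • y)]
  exact Module.Finite.of_restrictScalars_finite k (A ⊗[k] B) _

/-- Contraction of the factor `B` of the induced module along a linear form on `B`. -/
noncomputable def contractRight (ξ : B →ₗ[k] k) : G ⊗[k] B →ₗ[A] G :=
  { TensorProduct.lift (LinearMap.mk₂ k (fun x b ↦ ξ b • x) (by simp)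
        (fun _ _ _ ↦ smul_comm _ _ _) (by simp [add_smul]) (by simp [mul_smul])) with
    map_smul' := fun a x ↦ by
      induction x with
      | zero => simp
      | add y₁ y₂ h₁ h₂ => simp only [smul_add, AddHom.toFun_eq_coe, map_add,
          RingHom.id_apply] at h₁ h₂ ⊢; simp only [h₁, h₂]
      | tmul x b =>
        simp only [TensorProduct.smul_tmul', AddHom.toFun_eq_coe, LinearMap.coe_toAddHom,
          TensorProduct.lift.tmul, LinearMap.mk₂_apply, RingHom.id_apply]
        exact smul_comm _ _ _ }

theorem projective_left_of_projective [FiniteDimensional k B]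
    (N : Type*) [AddCommGroup N] [Module A N] [Module (A ⊗[k] B) N] [IsScalarTower A (A ⊗[k] B) N]
    [Module.Projective (A ⊗[k] B) N] : Module.Projective A N := by
  obtain ⟨s, hs⟩ := Module.projective_def'.1 ‹Module.Projective (A ⊗[k] B) N›
  have : Module.Free A (A ⊗[k] B) :=
    Module.Free.of_basis (Algebra.TensorProduct.basis A (Module.finBasis k B))
  exact Module.Projective.of_split (s.restrictScalars A)
    ((Finsupp.linearCombination (A ⊗[k] B) id).restrictScalars A)
    (by ext x; exact LinearMap.congr_fun hs x)

end Induced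

theorem IsCMFree.left_of_tensorProduct {k : Type u} {A : Type v} {B : Type w} [Field k] [Ring A]
    [Algebra k A] [FiniteDimensional k A] [Ring B] [Algebra k B] [FiniteDimensional k B]
    [Nontrivial B] (h : IsCMFree (A ⊗[k] B)) : IsCMFree A := by
  refine isCMFree_of_projective_ker fun P d hfin hproj hd hdA ↦ ?_
  let _ (i : ℤ) : Module k (P i) := Module.compHom (P i) (algebraMap k A)
  have _ (i : ℤ) : IsScalarTower k A (P i) := ⟨fun c a x ↦ by
    change (c • a) • x = algebraMap k A c • a • x
    rw [Algebra.smul_def, mul_smul]⟩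
  let _ (i : ℤ) : Module (A ⊗[k] B) (P i ⊗[k] B) := inducedModule k A B (P i)
  have hd' (i) : Function.Exact (inducedMap B (d i)) (inducedMap B (d (i + 1))) :=
    Module.Flat.rTensor_exact B (f := (d i).restrictScalars k)
      (g := (d (i + 1)).restrictScalars k) (hd i)
  -- Over `A` the ring `A ⊗ B` is a finite power of `A`.
  have hG : HomExact d (A ⊗[k] B) :=
    (HomExact.pi fun _ ↦ hdA).of_equiv
      (Algebra.TensorProduct.basis A (Module.finBasis k B)).equivFun
  have hproj' := h.projective_ker (P := fun i ↦ P i ⊗[k] B)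
    (d := fun i ↦ inducedMap (k := k) B (d i)) hd' (by
    intro i f hf
    obtain ⟨g, hg⟩ := hG i (f.restrictScalars A ∘ₗ inducedUnit) (by
      ext x
      exact LinearMap.congr_fun hf (x ⊗ₜ 1))
    refine ⟨inducedLift g, induced_hom_ext fun x ↦ ?_⟩
    have : g (d (i + 1) x) = f (x ⊗ₜ 1) := LinearMap.congr_fun hg x
    simp [inducedLift_tmul, this, ← Algebra.TensorProduct.one_def]) 1
  have hpA : Module.Projective A (LinearMap.ker (inducedMap (k := k) B (d 1))) :=
    projective_left_of_projective (k := k) (B := B) _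
  obtain ⟨ξ, hξ⟩ : ∃ ξ : B →ₗ[k] k, ξ 1 = 1 :=
    (LinearMap.exists_leftInverse_of_injective (Algebra.linearMap k B)
      (LinearMap.ker_eq_bot.2 (algebraMap k B).injective)).imp
      fun ξ hξ ↦ by simpa using LinearMap.congr_fun hξ 1
  let r (i : ℤ) := contractRight (A := A) (G := P i) ξ
  have hr (i x) (b : B) : r i (x ⊗ₜ b) = ξ b • x := rfl
  have hrd (x) : d 1 (r 1 x) = r (1 + 1) (inducedMap (k := k) B (d 1) x) := by
    induction x with
    | zero => simp
    | add x y hx hy => simp only [map_add, hx, hy]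
    | tmul x b => rw [hr, inducedMap_tmul, hr, LinearMap.map_smul_of_tower]
  -- The kernel of `d 1` is an `A`-summand of the induced kernel: include by `x ↦ x ⊗ 1`, retract by
  -- contracting with `ξ`.
  refine Module.Projective.of_split (M := LinearMap.ker (inducedMap (k := k) B (d 1)))
    { toFun := fun x ↦ ⟨x.1 ⊗ₜ 1, by
        have hx : d 1 x.1 = 0 := x.2
        rw [LinearMap.mem_ker, inducedMap_tmul, hx, TensorProduct.zero_tmul]⟩
      map_add' := fun x y ↦ Subtype.ext (TensorProduct.add_tmul ..)
      map_smul' := fun a x ↦ rfl }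
    { toFun := fun x ↦ ⟨r 1 x.1, by
        rw [LinearMap.mem_ker, hrd, LinearMap.mem_ker.1 x.2, map_zero]⟩
      map_add' := fun x y ↦ Subtype.ext ((r 1).map_add x y)
      map_smul' := fun a x ↦ Subtype.ext ((r 1).map_smul a x.1) } ?_
  ext x
  change r 1 (x.1 ⊗ₜ 1) = x.1
  rw [hr, hξ, one_smul]

/-! ### `Hom_k(U, W)` as an `A ⊗ B`-module, and coinduction from `B`. -/

section HomModule

open MulOpposite

/-- The left action on linear maps out of a right module, by precomposition. -/
instance (priority := low) precompModule {R S U W : Type*} [Ring R] [Ring S] [AddCommGroup U]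
    [Module S U] [Module Rᵐᵒᵖ U] [SMulCommClass Rᵐᵒᵖ S U] [AddCommGroup W] [Module S W] :
    Module R (U →ₗ[S] W) where
  smul r f := f ∘ₗ DistribSMul.toLinearMap S U (op r)
  one_smul f := by ext x; exact congrArg f (one_smul _ x)
  mul_smul r s f := by ext x; exact congrArg f (mul_smul (op s) (op r) x)
  smul_zero r := by ext; rfl
  smul_add r f g := by ext; rfl
  add_smul r s f := by
    ext x
    change f (op (r + s) • x) = f (op r • x) + f (op s • x)
    rw [op_add, add_smul, map_add]
  zero_smul f := by
    ext x
    change f (op (0 : R) • x) = 0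
    rw [op_zero, zero_smul, map_zero]

/-- The right action on linear maps out of a left module, by precomposition. -/
instance (priority := low) precompOpModule {R S X W : Type*} [Ring R] [Ring S] [AddCommGroup X]
    [Module S X] [Module R X] [SMulCommClass R S X] [AddCommGroup W] [Module S W] :
    Module Rᵐᵒᵖ (X →ₗ[S] W) where
  smul r f := f ∘ₗ DistribSMul.toLinearMap S X (unop r)
  one_smul f := by ext x; exact congrArg f (one_smul _ x)
  mul_smul r s f := by ext x; exact congrArg f (mul_smul (unop s) (unop r) x)
  smul_zero r := by ext; rfl
  smul_add r f g := by ext; rfl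
  add_smul r s f := by
    ext x
    change f (unop (r + s) • x) = f (unop r • x) + f (unop s • x)
    rw [unop_add, add_smul, map_add]
  zero_smul f := by
    ext x
    change f (unop (0 : Rᵐᵒᵖ) • x) = 0
    rw [unop_zero, zero_smul, map_zero]

section

variable {R S U W X : Type*} [Ring R] [Ring S] [AddCommGroup U] [Module S U] [Module Rᵐᵒᵖ U]
  [SMulCommClass Rᵐᵒᵖ S U] [AddCommGroup W] [Module S W] [AddCommGroup X] [Module S X] [Module R X]
  [SMulCommClass R S X]

theorem precomp_smul_apply (r : R) (f : U →ₗ[S] W) (x : U) : (r • f) x = f (op r • x) := rfl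

theorem precompOp_smul_apply (r : Rᵐᵒᵖ) (f : X →ₗ[S] W) (x : X) : (r • f) x = f (unop r • x) := rfl

end

section

variable {k : Type u} {A : Type v} {B : Type w} [Field k] [Ring A] [Algebra k A] [Ring B]
  [Algebra k B] {U V : Type*} [AddCommGroup U] [Module k U] [Module Aᵐᵒᵖ U]
  [IsScalarTower k Aᵐᵒᵖ U] [AddCommGroup V] [Module k V]

instance precomp_isScalarTower : IsScalarTower k A (U →ₗ[k] V) := by
  refine ⟨fun c a f ↦ ?_⟩
  ext x
  rw [precomp_smul_apply, LinearMap.smul_apply, precomp_smul_apply, op_smul, smul_assoc, map_smul]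

instance precompOp_isScalarTower {X : Type*} [AddCommGroup X] [Module k X] [Module A X]
    [IsScalarTower k A X] {W : Type*} [AddCommGroup W] [Module B W] [Module k W]
    [IsScalarTower k B W] [Module B X] [IsScalarTower k B X] [SMulCommClass A B X] :
    IsScalarTower k Aᵐᵒᵖ (X →ₗ[B] W) := by
  refine ⟨fun c a f ↦ ?_⟩
  ext x
  rw [precompOp_smul_apply, LinearMap.smul_apply, precompOp_smul_apply, unop_smul, smul_assoc,
    LinearMap.map_smul_of_tower]

variable [Module B V] [IsScalarTower k B V]

instance precomp_smulCommClass_left : SMulCommClass A B (U →ₗ[k] V) :=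
  ⟨fun _ _ _ ↦ by ext; rfl⟩

instance precomp_smulCommClass_right : SMulCommClass B A (U →ₗ[k] V) :=
  ⟨fun _ _ _ ↦ by ext; rfl⟩

end

section TensorModule

variable (k : Type u) (A : Type v) (B : Type w) [Field k] [Ring A] [Algebra k A] [Ring B]
  [Algebra k B]

/-- The action of `A ⊗ B` on `M` is given by actions of `A` and `B`. -/
class IsTensorModule (M : Type*) [AddCommGroup M] [Module A M] [Module B M]
    [Module (A ⊗[k] B) M] : Prop where
  tmul_smul : ∀ (a : A) (b : B) (m : M), (a ⊗ₜ[k] b) • m = a • b • m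

noncomputable instance homTensorModule {U V : Type*} [AddCommGroup U] [Module k U]
    [AddCommGroup V] [Module k V] [Module A (U →ₗ[k] V)] [Module B (U →ₗ[k] V)]
    [IsScalarTower k A (U →ₗ[k] V)] [IsScalarTower k B (U →ₗ[k] V)]
    [SMulCommClass A B (U →ₗ[k] V)] : Module (A ⊗[k] B) (U →ₗ[k] V) :=
  TensorProduct.Algebra.module

instance hom_isTensorModule {U V : Type*} [AddCommGroup U] [Module k U]
    [AddCommGroup V] [Module k V] [Module A (U →ₗ[k] V)] [Module B (U →ₗ[k] V)]
    [IsScalarTower k A (U →ₗ[k] V)] [IsScalarTower k B (U →ₗ[k] V)]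
    [SMulCommClass A B (U →ₗ[k] V)] : IsTensorModule k A B (U →ₗ[k] V) :=
  ⟨fun _ _ _ ↦ rfl⟩

variable {A B}

theorem smul_comm_of_isTensorModule {M : Type*} [AddCommGroup M] [Module A M] [Module B M]
    [Module (A ⊗[k] B) M] [IsTensorModule k A B M] (a : A) (b : B) (m : M) :
    a • b • m = b • a • m := by
  have hA (x : M) : a • x = (a ⊗ₜ[k] (1 : B)) • x := by
    rw [IsTensorModule.tmul_smul, one_smul]
  have hB (x : M) : b • x = ((1 : A) ⊗ₜ[k] b) • x := by
    rw [IsTensorModule.tmul_smul, one_smul]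
  rw [hA, hB, hB, hA, smul_smul, smul_smul]
  simp

variable {k}

section

variable {M : Type*} [AddCommGroup M] [Module A M] [Module B M] [Module (A ⊗[k] B) M]
  [IsTensorModule k A B M] {N : Type*} [AddCommGroup N] [Module A N] [Module B N]
  [Module (A ⊗[k] B) N] [IsTensorModule k A B N]

variable (k B) in
theorem left_smul_eq (a : A) (m : M) : a • m = (a ⊗ₜ[k] (1 : B)) • m := by
  rw [IsTensorModule.tmul_smul, one_smul]

variable (k A) in
theorem right_smul_eq (b : B) (m : M) : b • m = ((1 : A) ⊗ₜ[k] b) • m := by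
  rw [IsTensorModule.tmul_smul, one_smul]

/-- The `A`-linear map underlying an `A ⊗ B`-linear map. -/
def toLeft (f : M →ₗ[A ⊗[k] B] N) : M →ₗ[A] N :=
  { f with
    map_smul' := fun a x ↦ by
      simp [left_smul_eq k B] }

/-- The `B`-linear map underlying an `A ⊗ B`-linear map. -/
def toRight (f : M →ₗ[A ⊗[k] B] N) : M →ₗ[B] N :=
  { f with
    map_smul' := fun a x ↦ by
      simp [right_smul_eq k A] }

@[simp] theorem toLeft_apply (f : M →ₗ[A ⊗[k] B] N) (x : M) : toLeft f x = f x := rfl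

@[simp] theorem toRight_apply (f : M →ₗ[A ⊗[k] B] N) (x : M) : toRight f x = f x := rfl

variable (k) in
/-- An additive map that is linear over `A` and over `B` is linear over `A ⊗ B`. -/
def tensorLinear (f : M →+ N) (hA : ∀ (a : A) x, f (a • x) = a • f x)
    (hB : ∀ (b : B) x, f (b • x) = b • f x) : M →ₗ[A ⊗[k] B] N :=
  { f with
    map_smul' := fun t x ↦ by
      change f (t • x) = t • f x
      induction t with
      | zero => simp
      | add s t hs ht => simp [add_smul, hs, ht]
      | tmul a b => rw [IsTensorModule.tmul_smul, hA, hB, IsTensorModule.tmul_smul] }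

@[simp] theorem tensorLinear_apply (f : M →+ N) (hA : ∀ (a : A) x, f (a • x) = a • f x)
    (hB : ∀ (b : B) x, f (b • x) = b • f x) (x : M) : tensorLinear k f hA hB x = f x := rfl

end

section Hom

variable {U U' W W' : Type*} [AddCommGroup U] [Module k U] [Module Aᵐᵒᵖ U]
  [IsScalarTower k Aᵐᵒᵖ U] [AddCommGroup U'] [Module k U'] [Module Aᵐᵒᵖ U']
  [IsScalarTower k Aᵐᵒᵖ U'] [AddCommGroup W] [Module k W] [Module B W] [IsScalarTower k B W]
  [AddCommGroup W'] [Module k W'] [Module B W'] [IsScalarTower k B W']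

variable (W) in
/-- Precomposition with a map of right `A`-modules. -/
noncomputable def homPrecomp (φ : U →ₗ[Aᵐᵒᵖ] U') : (U' →ₗ[k] W) →ₗ[A ⊗[k] B] (U →ₗ[k] W) :=
  tensorLinear k (LinearMap.lcomp k W (φ.restrictScalars k)).toAddMonoidHom
    (fun a f ↦ by
      ext x
      exact (congrArg f (φ.map_smul (op a) x)).symm)
    (fun b f ↦ by ext; rfl)

@[simp] theorem homPrecomp_apply (φ : U →ₗ[Aᵐᵒᵖ] U') (f : U' →ₗ[k] W) (x : U) :
    homPrecomp (B := B) W φ f x = f (φ x) := rfl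

variable (U) in
/-- Postcomposition with a map of `B`-modules. -/
noncomputable def homPostcomp (φ : W →ₗ[B] W') : (U →ₗ[k] W) →ₗ[A ⊗[k] B] (U →ₗ[k] W') :=
  tensorLinear k (LinearMap.llcomp k U W W' (φ.restrictScalars k)).toAddMonoidHom
    (fun a f ↦ by ext; rfl)
    (fun b f ↦ by ext x; exact φ.map_smul b (f x))

@[simp] theorem homPostcomp_apply (φ : W →ₗ[B] W') (f : U →ₗ[k] W) (x : U) :
    homPostcomp (A := A) U φ f x = φ (f x) := rfl

variable {M : Type*} [AddCommGroup M] [Module k M] [Module A M] [Module B M]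
  [IsScalarTower k A M] [IsScalarTower k B M] [Module (A ⊗[k] B) M] [IsTensorModule k A B M]

/-- A `B`-linear map `M → W` gives an `A ⊗ B`-linear map from `M` to the coinduced module
`Hom_k(A, W)`. -/
noncomputable def toCoinduced (f : M →ₗ[B] W) : M →ₗ[A ⊗[k] B] (A →ₗ[k] W) :=
  tensorLinear k
    { toFun := fun m ↦
        { toFun := fun a ↦ f (a • m)
          map_add' := fun a a' ↦ by rw [add_smul, map_add]
          map_smul' := fun c a ↦ by rw [smul_assoc, LinearMap.map_smul_of_tower]; rfl }
      map_zero' := by ext; simp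
      map_add' := fun x y ↦ by ext; simp }
    (fun a x ↦ by
      ext y
      change f (y • a • x) = f ((op a • y) • x)
      rw [smul_smul]
      rfl)
    (fun b x ↦ by
      ext y
      change f (y • b • x) = b • f (y • x)
      rw [smul_comm_of_isTensorModule k, map_smul])

@[simp] theorem toCoinduced_apply (f : M →ₗ[B] W) (m : M) (a : A) :
    toCoinduced (k := k) f m a = f (a • m) := rfl

/-- Evaluation at `1` on the coinduced module. -/
def coinducedEval : (A →ₗ[k] W) →ₗ[B] W where
  toFun f := f 1
  map_add' _ _ := rfl
  map_smul' _ _ := rfl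

/-- Coinduction `Hom_k(A, -)` is right adjoint to restriction and preserves surjections, since they
split over `k`. Hence restriction to `B` preserves projectives. -/
theorem exists_lift_right [Module.Projective (A ⊗[k] B) M] (π : W →ₗ[B] W')
    (hπ : Function.Surjective π) (f : M →ₗ[B] W') : ∃ g : M →ₗ[B] W, π ∘ₗ g = f := by
  obtain ⟨s, hs⟩ := (π.restrictScalars k).exists_rightInverse_of_surjective
    (LinearMap.range_eq_top.2 hπ)
  obtain ⟨g, hg⟩ := Module.projective_lifting_property (homPostcomp (A := A) (k := k) A π)
    (toCoinduced f) (fun h ↦ ⟨s ∘ₗ h, by ext x; exact LinearMap.congr_fun hs (h x)⟩)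
  refine ⟨coinducedEval ∘ₗ toRight g, ?_⟩
  ext x
  have := LinearMap.congr_fun (LinearMap.congr_fun hg x) (1 : A)
  simpa [coinducedEval] using this

variable (k A B M) in
theorem projective_right_of_projective [Module.Projective (A ⊗[k] B) M] :
    Module.Projective B M :=
  Module.Projective.of_lifting_property'' fun f hf ↦
    exists_lift_right (k := k) (A := A) f hf LinearMap.id

end Hom

end TensorModule

end HomModule

/-! ### Restricting complete resolutions from `A ⊗ B` to `B`. -/

section Restriction

open MulOpposite

variable {k : Type u} {A : Type v} {B : Type w} [Field k] [Ring A] [Algebra k A] [Ring B]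
  [Algebra k B] [FiniteDimensional k A]

/-- The `A ⊗ B`-module `Hom_k(D A, B)` is free of rank one. -/
noncomputable def homDualEquiv {D : Type*} [AddCommGroup D] [Module k D] [Module Aᵐᵒᵖ D]
    [IsScalarTower k Aᵐᵒᵖ D] (e : D ≃ₗ[k] Module.Dual k A)
    (he : ∀ (a : A) (ξ : D) (x : A), e (op a • ξ) x = e ξ (a * x)) :
    (A ⊗[k] B) ≃ₗ[A ⊗[k] B] (D →ₗ[k] B) :=
  let E : (A ⊗[k] B) ≃ₗ[k] (D →ₗ[k] B) :=
    (TensorProduct.congr (Module.evalEquiv k A) (.refl k B)).trans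
      ((dualTensorHomEquiv k (Module.Dual k A) B).trans (e.symm.arrowCongr (.refl k B)))
  { E with
    map_smul' := fun s t ↦ by
      have hE (a : A) (b : B) (ξ : D) : E (a ⊗ₜ b) ξ = e ξ a • b := by
        simp [E, dualTensorHomEquiv]
      change E (s * t) = s • E t
      induction s with
      | zero => rw [zero_mul, map_zero, zero_smul]
      | add s₁ s₂ h₁ h₂ => rw [add_mul, map_add, h₁, h₂, add_smul]
      | tmul a b =>
        induction t with
        | zero => simp
        | add t₁ t₂ h₁ h₂ => rw [mul_add, map_add, h₁, h₂, map_add, smul_add]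
        | tmul a' b' =>
          rw [IsTensorModule.tmul_smul, Algebra.TensorProduct.tmul_mul_tmul]
          ext ξ
          rw [hE, precomp_smul_apply, LinearMap.smul_apply, hE, he, smul_comm, smul_eq_mul] }

variable {P : ℤ → Type w₁} [∀ i, AddCommGroup (P i)] [∀ i, Module (A ⊗[k] B) (P i)]
  {d : ∀ i, P i →ₗ[A ⊗[k] B] P (i + 1)}

/-- A basis of `V` writes `Hom_k(A, V)` as a finite sum of copies of `DA`, so the coefficients are a
retract of a power of `Hom_k(DA, B) ≅ A ⊗ B`. -/
theorem homExact_hom_coinduced (h : HomExact d (A ⊗[k] B)) (V : Type*) [AddCommGroup V] [Module k V]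
    [FiniteDimensional k V] : HomExact d ((A →ₗ[k] V) →ₗ[k] B) := by
  let b := Module.finBasis k V
  let s (j) : (A →ₗ[k] k) →ₗ[Aᵐᵒᵖ] (A →ₗ[k] V) :=
    { toFun := fun ξ ↦ ξ.smulRight (b j)
      map_add' := fun _ _ ↦ by ext; simp [add_smul]
      map_smul' := fun _ _ ↦ by ext; rfl }
  let r (j) : (A →ₗ[k] V) →ₗ[Aᵐᵒᵖ] (A →ₗ[k] k) :=
    { toFun := fun f ↦ b.coord j ∘ₗ f
      map_add' := fun _ _ ↦ by ext; simp
      map_smul' := fun _ _ ↦ by ext; rfl }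
  have hsr (f : A →ₗ[k] V) : ∑ j, s j (r j f) = f := by
    ext x
    simp [s, r, b.sum_repr]
  refine (HomExact.pi (ι := Fin (Module.finrank k V)) fun _ ↦
    h.of_equiv (homDualEquiv (D := A →ₗ[k] k) (.refl k _) fun _ _ _ ↦ rfl).symm).of_retract
    (LinearMap.pi fun j ↦ homPrecomp B (s j)) (∑ j, homPrecomp B (r j) ∘ₗ LinearMap.proj j) ?_
  ext h f
  have := congrArg h (hsr f)
  simpa [LinearMap.sum_apply] using this

omit [FiniteDimensional k A] in
theorem injective_coinduced (V : Type v) [AddCommGroup V] [Module k V] :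
    Module.Injective Aᵐᵒᵖ (A →ₗ[k] V) := by
  refine ⟨fun X Y _ _ _ _ f hf g ↦ ?_⟩
  let _ : Module k X := Module.compHom X (algebraMap k Aᵐᵒᵖ)
  let _ : Module k Y := Module.compHom Y (algebraMap k Aᵐᵒᵖ)
  have hX : IsScalarTower k Aᵐᵒᵖ X := ⟨fun c a x ↦ by
    change (c • a) • x = algebraMap k Aᵐᵒᵖ c • a • x
    rw [Algebra.smul_def, mul_smul]⟩
  have hY : IsScalarTower k Aᵐᵒᵖ Y := ⟨fun c a x ↦ by
    change (c • a) • x = algebraMap k Aᵐᵒᵖ c • a • x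
    rw [Algebra.smul_def, mul_smul]⟩
  let g₁ : X →ₗ[k] V := LinearMap.applyₗ (1 : A) ∘ₗ g.restrictScalars k
  obtain ⟨r, hr⟩ := (f.restrictScalars k).exists_leftInverse_of_injective
    (LinearMap.ker_eq_bot.2 hf)
  refine ⟨{ toFun := fun y ↦
              { toFun := fun a ↦ g₁ (r (op a • y))
                map_add' := fun a a' ↦ by rw [MulOpposite.op_add, add_smul, map_add, map_add]
                map_smul' := fun c a ↦ by
                  rw [MulOpposite.op_smul, smul_assoc, map_smul, map_smul]
                  rfl }
            map_add' := fun y y' ↦ by ext; simp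
            map_smul' := fun a y ↦ by
              ext x
              change g₁ (r (op x • a • y)) = g₁ (r (op (unop a * x) • y))
              rw [smul_smul]
              rfl }, fun x ↦ ?_⟩
  ext a
  change g₁ (r (op a • f x)) = g x a
  have : r (f (op a • x)) = op a • x := LinearMap.congr_fun hr _
  rw [← map_smul, this]
  change g (op a • x) 1 = g x a
  rw [map_smul, precompOp_smul_apply, unop_op, smul_eq_mul, mul_one]

variable [∀ i, Module.Projective (A ⊗[k] B) (P i)] (hd : ∀ i, Function.Exact (d i) (d (i + 1)))
  (h : HomExact d (A ⊗[k] B))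

omit [∀ i, Module.Projective (A ⊗[k] B) (P i)] in
include h in
theorem exists_embedding_coinduced (U : Type v) [AddCommGroup U] [Module k U] [Module Aᵐᵒᵖ U]
    [IsScalarTower k Aᵐᵒᵖ U] [FiniteDimensional k U] :
    ∃ (I : Type v) (_ : AddCommGroup I) (_ : Module k I) (_ : Module Aᵐᵒᵖ I)
      (_ : IsScalarTower k Aᵐᵒᵖ I) (_ : FiniteDimensional k I) (ι : U →ₗ[Aᵐᵒᵖ] I),
      Function.Injective ι ∧ Module.Injective Aᵐᵒᵖ I ∧ HomExact d (I →ₗ[k] B) := by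
  -- `V` is `U` as a bare vector space, so that precomposition is the only right `A`-action on
  -- `Hom_k(A, V)`.
  obtain ⟨V, _, _, ⟨e⟩⟩ : ∃ (V : Type v) (_ : AddCommGroup V) (_ : Module k V),
    Nonempty (U ≃ₗ[k] V) := ⟨U, _, _, ⟨.refl _ _⟩⟩
  have : FiniteDimensional k V := Module.Finite.equiv e
  refine ⟨A →ₗ[k] V, inferInstance, inferInstance, inferInstance, inferInstance, inferInstance,
    { toFun := fun x ↦
        { toFun := fun a ↦ e (op a • x)
          map_add' := fun a a' ↦ by rw [MulOpposite.op_add, add_smul, map_add]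
          map_smul' := fun c a ↦ by rw [MulOpposite.op_smul, smul_assoc, map_smul]; rfl }
      map_add' := fun y y' ↦ by ext; simp
      map_smul' := fun a y ↦ by
        ext x
        change e (op x • a • y) = e (op (unop a * x) • y)
        rw [smul_smul]
        rfl }, fun x y hxy ↦ ?_, injective_coinduced V, homExact_hom_coinduced h V⟩
  have : e (op (1 : A) • x) = e (op (1 : A) • y) := LinearMap.congr_fun hxy (1 : A)
  simpa using this

omit [FiniteDimensional k A] in
include hd in
-- The sequence splits over `k`, so `Hom_k(-, B)` turns it into a short exact sequence of `A ⊗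
-- B`-modules.
theorem homExact_hom_of_exact {U I Q : Type*} [AddCommGroup U] [Module k U] [Module Aᵐᵒᵖ U]
    [IsScalarTower k Aᵐᵒᵖ U] [AddCommGroup I] [Module k I] [Module Aᵐᵒᵖ I]
    [IsScalarTower k Aᵐᵒᵖ I] [AddCommGroup Q] [Module k Q] [Module Aᵐᵒᵖ Q]
    [IsScalarTower k Aᵐᵒᵖ Q] {ι : U →ₗ[Aᵐᵒᵖ] I} {π : I →ₗ[Aᵐᵒᵖ] Q} (hι : Function.Injective ι)
    (hex : Function.Exact ι π) (hπ : Function.Surjective π) (hQ : HomExact d (Q →ₗ[k] B))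
    (hI : HomExact d (I →ₗ[k] B)) : HomExact d (U →ₗ[k] B) := by
  obtain ⟨s, hs⟩ := (π.restrictScalars k).exists_rightInverse_of_surjective
    (LinearMap.range_eq_top.2 hπ)
  obtain ⟨r, hr⟩ := (ι.restrictScalars k).exists_leftInverse_of_injective
    (LinearMap.ker_eq_bot.2 hι)
  refine HomExact.of_left_of_middle hd (ι := homPrecomp B π) (π := homPrecomp B ι)
    ?_ ?_ ?_ hQ hI
  · intro f g hfg
    ext x
    obtain ⟨y, rfl⟩ := hπ x
    exact LinearMap.congr_fun hfg y
  · intro f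
    constructor
    · intro hf
      refine ⟨f ∘ₗ s, ?_⟩
      ext x
      have h1 : π (s (π x) - x) = 0 := by
        have : π (s (π x)) = π x := LinearMap.congr_fun hs _
        rw [map_sub, this, sub_self]
      obtain ⟨u, hu⟩ := (hex _).1 h1
      have h2 : f (ι u) = 0 := LinearMap.congr_fun hf u
      rw [hu, map_sub, sub_eq_zero] at h2
      exact h2
    · rintro ⟨g, rfl⟩
      ext u
      simp [hex.apply_apply_eq_zero u]
  · intro f
    refine ⟨f ∘ₗ r, ?_⟩
    ext u
    have : r (ι u) = u := LinearMap.congr_fun hr u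
    simp [this]

open CategoryTheory in
include hd h in
-- Dimension shifting on the right `A`-module `U` by coinduced injectives; an injective `U` is a
-- summand of one.
theorem homExact_hom_of_hasInjectiveDimensionLT (n : ℕ) :
    ∀ (U : Type v) [AddCommGroup U] [Module k U] [Module Aᵐᵒᵖ U] [IsScalarTower k Aᵐᵒᵖ U]
      [FiniteDimensional k U], HasInjectiveDimensionLT (ModuleCat.of Aᵐᵒᵖ U) (n + 1) →
      HomExact d (U →ₗ[k] B) := by
  induction n with
  | zero =>
    intro U _ _ _ _ _ hU
    obtain ⟨I, _, _, _, _, _, ι, hι, hI, hIB⟩ := exists_embedding_coinduced h U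
    have hinj : Injective (ModuleCat.of Aᵐᵒᵖ U) := by
      rwa [injective_iff_hasInjectiveDimensionLT_one]
    have := Module.injective_module_of_injective_object Aᵐᵒᵖ U
    obtain ⟨r, hr⟩ := this.out ι hι LinearMap.id
    refine hIB.of_retract (homPrecomp B r) (homPrecomp B ι) ?_
    ext f x
    simp [hr]
  | succ n ih =>
    intro U _ _ _ _ _ hU
    obtain ⟨I, _, _, _, _, _, ι, hι, hI, hIB⟩ := exists_embedding_coinduced h U
    let π := (LinearMap.range ι).mkQ
    have hπ : Function.Surjective π := Submodule.mkQ_surjective _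
    have hex : Function.Exact ι π := LinearMap.exact_map_mkQ_range ι
    let S : ShortComplex (ModuleCat.{v} Aᵐᵒᵖ) :=
      ShortComplex.mk (ModuleCat.ofHom ι) (ModuleCat.ofHom π) (by
        ext x; exact hex.apply_apply_eq_zero x)
    have hS : S.ShortExact :=
      { exact := (ShortComplex.ShortExact.moduleCat_exact_iff_function_exact S).2 hex
        mono_f := (ModuleCat.mono_iff_injective _).2 hι
        epi_g := (ModuleCat.epi_iff_surjective _).2 hπ }
    have h2 : Injective S.X₂ := Module.injective_object_of_injective_module _ _
    have h3 : HasInjectiveDimensionLT S.X₃ (n + 1) :=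
      (hS.hasInjectiveDimensionLT_X₃_iff n h2).2 hU
    have hQ := ih _ h3
    exact homExact_hom_of_exact hd hι hex hπ hQ hIB

variable [∀ i, Module k (P i)] [∀ i, Module A (P i)] [∀ i, Module B (P i)]
  [∀ i, IsScalarTower k A (P i)] [∀ i, IsScalarTower k B (P i)] [∀ i, IsTensorModule k A B (P i)]

omit [FiniteDimensional k A] [∀ i, Module.Projective (A ⊗[k] B) (P i)] in
theorem homExact_toRight {W : Type*} [AddCommGroup W] [Module k W] [Module B W]
    [IsScalarTower k B W] (h : HomExact d (A →ₗ[k] W)) :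
    HomExact (fun i ↦ toRight (d i)) W := by
  intro i f hf
  obtain ⟨g, hg⟩ := h i (toCoinduced f) (by
    ext x a
    have : f (d i (a • x)) = 0 := LinearMap.congr_fun hf (a • x)
    rw [← toLeft_apply (d i), map_smul] at this
    exact this)
  refine ⟨coinducedEval ∘ₗ toRight g, ?_⟩
  ext x
  have : g (d (i + 1) x) 1 = f ((1 : A) • x) :=
    LinearMap.congr_fun (LinearMap.congr_fun hg x) 1
  rw [one_smul] at this
  exact this

open CategoryTheory in
include hd h in
/-- If `A` has finite injective dimension as a right module, a complete resolution over `A ⊗ B`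
restricts to a complete resolution over `B`. -/
theorem homExact_toRight_of_isGorenstein (hA : IsGorenstein A) :
    HomExact (fun i ↦ toRight (d i)) B := by
  obtain ⟨n, hn⟩ := (injectiveDimension_ne_top_iff _).1 hA.2.ne
  exact homExact_toRight (homExact_hom_of_hasInjectiveDimensionLT hd h n A hn)

end Restriction

/-! ### The functor `N ⊗_B -` and its right adjoint `Hom_k(N, -)`. -/

section BalancedTensor

open MulOpposite

variable (k : Type u) (A : Type v) {B : Type w} [Field k] [Ring A] [Algebra k A] [Ring B]
  [Algebra k B] (M : Type w₁) [AddCommGroup M] [Module k M] [Module A M] [Module B M]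
  [IsScalarTower k A M] [IsScalarTower k B M]
  (N : Type w₂) [AddCommGroup N] [Module k N] [Module Bᵐᵒᵖ N] [IsScalarTower k Bᵐᵒᵖ N]

variable (B) in
/-- The relations defining the tensor product over `B` of a left module `M` and a right
module `N`. -/
def balancedRelations : Submodule A (M ⊗[k] N) :=
  Submodule.span A {t | ∃ (b : B) (m : M) (n : N), t = (b • m) ⊗ₜ n - m ⊗ₜ (op b • n)}

variable (B) in
/-- The `A`-module `N ⊗_B M` for an `A`-`B`-module `M` and a right `B`-module `N`. -/
abbrev BalancedTensor : Type _ := (M ⊗[k] N) ⧸ balancedRelations k A B M N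

variable {k A M N}

variable (k A B) in
/-- The class of a pure tensor in the tensor product over `B`. -/
def balancedMk (m : M) (n : N) : BalancedTensor k A B M N := Submodule.Quotient.mk (m ⊗ₜ n)

omit [Algebra k B] [IsScalarTower k B M] [IsScalarTower k Bᵐᵒᵖ N] in
theorem balancedMk_smul (b : B) (m : M) (n : N) :
    balancedMk k A B (b • m) n = balancedMk k A B m (op b • n) :=
  (Submodule.Quotient.eq _).2 (Submodule.subset_span ⟨b, m, n, rfl⟩)

omit [Algebra k B] [IsScalarTower k B M] [IsScalarTower k Bᵐᵒᵖ N] in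
theorem balancedTensor_induction {p : BalancedTensor k A B M N → Prop} (zero : p 0)
    (add : ∀ x y, p x → p y → p (x + y)) (mk : ∀ m n, p (balancedMk k A B m n)) (x) : p x := by
  induction x using Submodule.Quotient.induction_on with
  | _ t =>
    induction t with
    | zero => exact zero
    | add x y hx hy => exact add _ _ hx hy
    | tmul m n => exact mk m n

variable (hcomm : ∀ (a : A) (b : B) (m : M), a • b • m = b • a • m)

include hcomm in
theorem exists_balanced_lift {V : Type*} [AddCommGroup V] [Module k V] (φ : M →ₗ[B] (N →ₗ[k] V)) :
    ∃ g : BalancedTensor k A B M N →ₗ[k] V, ∀ m n, g (balancedMk k A B m n) = φ m n := by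
  let g₀ : M ⊗[k] N →ₗ[k] V := TensorProduct.lift (φ.restrictScalars k)
  have hg₀ : (balancedRelations k A B M N).restrictScalars k ≤ LinearMap.ker g₀ := by
    intro x hx
    -- The relations are an `A`-span while `g₀` is only `k`-linear, so all `A`-multiples are treated
    -- at once.
    have key : ∀ a : A, g₀ (a • x) = 0 := by
      have hx' : x ∈ balancedRelations k A B M N := hx
      unfold balancedRelations at hx'
      clear hx
      induction hx' using Submodule.span_induction with
      | mem x hx =>
        obtain ⟨b, m, n, rfl⟩ := hx
        intro a
        rw [smul_sub, TensorProduct.smul_tmul', TensorProduct.smul_tmul', hcomm]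
        have : φ (b • a • m) n = φ (a • m) (op b • n) := by rw [map_smul]; rfl
        rw [map_sub, TensorProduct.lift.tmul, TensorProduct.lift.tmul]
        exact sub_eq_zero.2 this
      | zero => simp
      | add x y _ _ hx hy => intro a; rw [smul_add, map_add, hx, hy, add_zero]
      | smul c x _ hx => intro a; rw [smul_smul]; exact hx _
    simpa using key 1
  exact ⟨((balancedRelations k A B M N).restrictScalars k).liftQ g₀ hg₀, fun m n ↦ rfl⟩

include hcomm in
theorem exists_balanced_lift_linear {V : Type*} [AddCommGroup V] [Module k V] [Module A V]
    [IsScalarTower k A V] (φ : M →ₗ[B] (N →ₗ[k] V)) (hφ : ∀ (a : A) m, φ (a • m) = a • φ m) :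
    ∃ g : BalancedTensor k A B M N →ₗ[A] V, ∀ m n, g (balancedMk k A B m n) = φ m n := by
  obtain ⟨g, hg⟩ := exists_balanced_lift hcomm φ
  refine ⟨{ g with map_smul' := fun a x ↦ ?_ }, hg⟩
  change g (a • x) = a • g x
  induction x using balancedTensor_induction with
  | zero => simp
  | add x y hx hy => rw [smul_add, map_add, hx, hy, map_add, smul_add]
  | mk m n =>
    change g (balancedMk k A B (a • m) n) = _
    rw [hg, hg, hφ]
    rfl

omit [Algebra k B] [IsScalarTower k B M] [IsScalarTower k Bᵐᵒᵖ N] in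
theorem balanced_hom_ext {V : Type*} [AddCommGroup V] [Module A V]
    {f g : BalancedTensor k A B M N →ₗ[A] V}
    (h : ∀ m n, f (balancedMk k A B m n) = g (balancedMk k A B m n)) : f = g := by
  refine LinearMap.ext fun x ↦ ?_
  induction x using balancedTensor_induction with
  | zero => simp
  | add x y hx hy => rw [map_add, map_add, hx, hy]
  | mk m n => exact h m n

variable [Module (A ⊗[k] B) M] [IsTensorModule k A B M]

variable (B N) in
omit [Module k M] [Module A M] [Module B M] [IsScalarTower k A M] [IsScalarTower k B M] in
/-- Postcomposition with a map of `A`-modules. -/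
noncomputable def homPostcompLeft {V V' : Type*} [AddCommGroup V] [Module k V] [Module A V]
    [IsScalarTower k A V] [AddCommGroup V'] [Module k V'] [Module A V'] [IsScalarTower k A V']
    (f : V →ₗ[A] V') : (N →ₗ[k] V) →ₗ[A ⊗[k] B] (N →ₗ[k] V') :=
  tensorLinear k (M := N →ₗ[k] V) (N := N →ₗ[k] V')
    (LinearMap.llcomp k N V V' (f.restrictScalars k)).toAddMonoidHom
    (fun a g ↦ by ext n; exact f.map_smul a (g n)) (fun b g ↦ by ext; rfl)

variable (M N) in
/-- The unit `M → Hom_k(N, N ⊗_B M)`. -/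
noncomputable def balancedUnit : M →ₗ[A ⊗[k] B] (N →ₗ[k] BalancedTensor k A B M N) :=
  tensorLinear k
    { toFun := fun m ↦
        { toFun := fun n ↦ balancedMk k A B m n
          map_add' := fun x y ↦
            congrArg (balancedRelations k A B M N).mkQ (TensorProduct.tmul_add ..)
          map_smul' := fun c x ↦
            congrArg (balancedRelations k A B M N).mkQ (TensorProduct.tmul_smul ..) }
      map_zero' := by
        ext n
        exact congrArg (balancedRelations k A B M N).mkQ (TensorProduct.zero_tmul ..)
      map_add' := fun x y ↦ by
        ext n
        exact congrArg (balancedRelations k A B M N).mkQ (TensorProduct.add_tmul ..) }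
    (fun a x ↦ by ext n; rfl)
    (fun b x ↦ by ext n; exact balancedMk_smul b x n)

omit [IsScalarTower k B M] in
@[simp] theorem balancedUnit_apply (m : M) (n : N) :
    balancedUnit M N m n = balancedMk k A B m n := rfl

variable {M' : Type*} [AddCommGroup M'] [Module k M'] [Module A M'] [Module B M']
  [IsScalarTower k A M'] [IsScalarTower k B M'] [Module (A ⊗[k] B) M'] [IsTensorModule k A B M']

theorem exists_lift_of_tensorLinear {V : Type*} [AddCommGroup V] [Module k V] [Module A V]
    [IsScalarTower k A V] (φ : M →ₗ[A ⊗[k] B] (N →ₗ[k] V)) :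
    ∃ g : BalancedTensor k A B M N →ₗ[A] V, ∀ m n, g (balancedMk k A B m n) = φ m n :=
  exists_balanced_lift_linear (smul_comm_of_isTensorModule k) (toRight φ) fun a m ↦
    (toLeft φ).map_smul a m

omit [IsScalarTower k B M'] in
variable (N) in
theorem exists_balanced_map (f : M →ₗ[A ⊗[k] B] M') :
    ∃ g : BalancedTensor k A B M N →ₗ[A] BalancedTensor k A B M' N,
      ∀ m n, g (balancedMk k A B m n) = balancedMk k A B (f m) n :=
  exists_lift_of_tensorLinear (balancedUnit M' N ∘ₗ f)

variable (N) in
/-- Functoriality of the tensor product over `B`. -/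
noncomputable def balancedMap (f : M →ₗ[A ⊗[k] B] M') :
    BalancedTensor k A B M N →ₗ[A] BalancedTensor k A B M' N :=
  (exists_balanced_map N f).choose

omit [IsScalarTower k B M'] in
@[simp] theorem balancedMap_mk (f : M →ₗ[A ⊗[k] B] M') (m : M) (n : N) :
    balancedMap N f (balancedMk k A B m n) = balancedMk k A B (f m) n :=
  (exists_balanced_map N f).choose_spec m n

variable (k A B M N) in
-- The right adjoint `Hom_k(N, -)` preserves surjections, as these split over `k`.
theorem projective_balancedTensor [Module.Projective (A ⊗[k] B) M] :
    Module.Projective A (BalancedTensor k A B M N) := by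
  refine Module.Projective.of_lifting_property'' fun f hf ↦ ?_
  obtain ⟨s, hs⟩ := (f.restrictScalars k).exists_rightInverse_of_surjective
    (LinearMap.range_eq_top.2 hf)
  obtain ⟨g, hg⟩ := Module.projective_lifting_property (homPostcompLeft B N f) (balancedUnit M N)
    (fun h ↦ ⟨s ∘ₗ h, by ext x; exact LinearMap.congr_fun hs (h x)⟩)
  obtain ⟨G, hG⟩ := exists_lift_of_tensorLinear g
  refine ⟨G, balanced_hom_ext fun m n ↦ ?_⟩
  have : f (g m n) = balancedMk k A B m n := LinearMap.congr_fun (LinearMap.congr_fun hg m) n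
  simp [hG, this]

omit [IsTensorModule k A B M] [IsScalarTower k B M] [IsScalarTower k Bᵐᵒᵖ N] in
variable (k A B M N) in
theorem finite_balancedTensor [FiniteDimensional k A] [FiniteDimensional k B]
    [FiniteDimensional k N] [IsScalarTower k (A ⊗[k] B) M] [Module.Finite (A ⊗[k] B) M] :
    Module.Finite A (BalancedTensor k A B M N) := by
  have : Module.Finite k M := Module.Finite.trans (A ⊗[k] B) M
  have : Module.Finite A (M ⊗[k] N) := Module.Finite.of_restrictScalars_finite k A _
  infer_instance

variable {P : ℤ → Type w₁} [∀ i, AddCommGroup (P i)] [∀ i, Module (A ⊗[k] B) (P i)]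
  {d : ∀ i, P i →ₗ[A ⊗[k] B] P (i + 1)}
  [∀ i, Module k (P i)] [∀ i, Module A (P i)] [∀ i, Module B (P i)]
  [∀ i, IsScalarTower k A (P i)] [∀ i, IsScalarTower k B (P i)] [∀ i, IsTensorModule k A B (P i)]
  (hd : ∀ i, Function.Exact (d i) (d (i + 1)))

include hd in
variable (N) in
-- Test with the cokernel `C` of the incoming map: by adjunction and `hB` for `Hom_k(N, C)`, the
-- projection to `C` factors through the outgoing map, so cycles are boundaries.
theorem balancedMap_exact (hB : ∀ (W : Type (max w₁ w₂)) [AddCommGroup W] [Module B W],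
      HomExact (fun i ↦ toRight (d i)) W) (i : ℤ) :
    Function.Exact (balancedMap N (d i)) (balancedMap N (d (i + 1))) := by
  intro x
  constructor
  · intro hx
    let q := (LinearMap.range (balancedMap N (d i))).mkQ
    let φ : P (i + 1) →ₗ[B] (N →ₗ[k] _) :=
      toRight (homPostcompLeft B N q ∘ₗ balancedUnit (P (i + 1)) N)
    have hφ m n : φ m n = q (balancedMk k A B m n) := rfl
    obtain ⟨g, hg⟩ := hB _ i φ (by
      ext m n
      change q (balancedMk k A B (d i m) n) = 0
      rw [← balancedMap_mk, Submodule.mkQ_apply, Submodule.Quotient.mk_eq_zero]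
      exact ⟨_, rfl⟩)
    obtain ⟨G, hG⟩ := exists_balanced_lift (A := A) (smul_comm_of_isTensorModule k) g
    have hq y : G (balancedMap N (d (i + 1)) y) = q y := by
      induction y using balancedTensor_induction with
      | zero => simp
      | add x y hx hy => rw [map_add, map_add, hx, hy, map_add]
      | mk m n =>
        rw [balancedMap_mk, hG, ← hφ]
        exact LinearMap.congr_fun (LinearMap.congr_fun hg m) n
    have hqx : q x = 0 := by rw [← hq, hx, map_zero]
    exact (Submodule.Quotient.mk_eq_zero _).1 hqx
  · rintro ⟨x, rfl⟩
    induction x using balancedTensor_induction with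
    | zero => simp
    | add x y hx hy => rw [map_add, map_add, hx, hy, add_zero]
    | mk m n =>
      rw [balancedMap_mk, balancedMap_mk, (hd i).apply_apply_eq_zero]
      exact LinearMap.congr_fun (map_zero (balancedUnit _ N)) n

theorem homExact_hom_of_homExact_balancedMap {V : Type*} [AddCommGroup V] [Module k V] [Module A V]
    [IsScalarTower k A V] (h : HomExact (fun i ↦ balancedMap N (d i)) V) :
    HomExact d (N →ₗ[k] V) := by
  intro i f hf
  obtain ⟨F, hF⟩ := exists_lift_of_tensorLinear f
  obtain ⟨G, hG⟩ := h i F (balanced_hom_ext fun m n ↦ by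
    rw [LinearMap.comp_apply, balancedMap_mk, hF]
    exact LinearMap.congr_fun (LinearMap.congr_fun hf m) n)
  refine ⟨homPostcompLeft B N G ∘ₗ balancedUnit _ N, ?_⟩
  ext m n
  have := LinearMap.congr_fun hG (balancedMk k A B m n)
  rw [LinearMap.comp_apply, balancedMap_mk, hF] at this
  exact this

end BalancedTensor

/-! ### A density theorem and evaluation of simple modules. -/

section Density

variable {k R X T : Type*} [Field k] [Ring R] [Algebra k R] [AddCommGroup X] [Module R X]
  [AddCommGroup T] [Module R T] [Module k T] [IsScalarTower k R T]

/-- Induction on `n`. If the last map vanishes on the common kernel of the others, it factors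
through `T ^ n`, and since `End T = k` it is a `k`-combination of them. Otherwise it maps that
kernel onto the simple module `T`. -/
theorem surjective_pi_of_linearIndependent [IsSimpleModule R T]
    (hT : Function.Surjective (algebraMap k (Module.End R T))) {n : ℕ} {φ : Fin n → X →ₗ[R] T}
    (hφ : LinearIndependent k φ) : Function.Surjective (LinearMap.pi φ) := by
  induction n with
  | zero => exact fun t ↦ ⟨0, Subsingleton.elim _ _⟩
  | succ n ih =>
    obtain ⟨h1, h2⟩ := linearIndependent_finSucc'.1 hφ
    let ψ := LinearMap.pi (Fin.init φ)
    have hψ : Function.Surjective ψ := ih h1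
    by_cases hker : LinearMap.ker ψ ≤ LinearMap.ker (φ (Fin.last n))
    · refine absurd ?_ h2
      let c : (Fin n → T) →ₗ[R] T := (LinearMap.ker ψ).liftQ _ hker ∘ₗ
        (ψ.quotKerEquivOfSurjective hψ).symm.toLinearMap
      have hc : ∀ x, c (ψ x) = φ (Fin.last n) x := by
        intro x
        have : (ψ.quotKerEquivOfSurjective hψ).symm (ψ x) = Submodule.Quotient.mk x := by
          rw [LinearEquiv.symm_apply_eq]
          rfl
        simp [c, this]
      choose a ha using fun j ↦ hT (c ∘ₗ LinearMap.single R (fun _ ↦ T) j)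
      have : φ (Fin.last n) = ∑ j, a j • Fin.init φ j := by
        ext x
        rw [← hc, LinearMap.sum_apply]
        refine (congrArg c (Finset.univ_sum_single (ψ x)).symm).trans ?_
        rw [map_sum]
        exact Finset.sum_congr rfl fun j _ ↦ (LinearMap.congr_fun (ha j) (ψ x j)).symm
      rw [this]
      exact Submodule.sum_mem _ fun j _ ↦
        Submodule.smul_mem _ _ (Submodule.subset_span ⟨j, rfl⟩)
    · intro t
      obtain ⟨x, hx⟩ := hψ (Fin.init t)
      let θ := φ (Fin.last n) ∘ₗ (LinearMap.ker ψ).subtype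
      have hθ : Function.Surjective θ := by
        refine LinearMap.surjective_of_ne_zero fun h ↦ hker fun y hy ↦ ?_
        exact LinearMap.congr_fun h ⟨y, hy⟩
      obtain ⟨⟨y, hy⟩, hy'⟩ := hθ (t (Fin.last n) - φ (Fin.last n) x)
      refine ⟨x + y, ?_⟩
      ext j
      refine Fin.lastCases ?_ (fun j ↦ ?_) j
      · have : φ (Fin.last n) y = t (Fin.last n) - φ (Fin.last n) x := hy'
        simp [this]
      · have h3 : φ j.castSucc x = t j.castSucc := congrFun hx j
        have h4 : φ j.castSucc y = 0 := congrFun hy j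
        simp [h3, h4]

/-- Density: evaluation of maps into a simple module with trivial endomorphisms. -/
theorem exists_forall_apply_eq [IsSimpleModule R T]
    (hT : Function.Surjective (algebraMap k (Module.End R T))) {H : Type*} [AddCommGroup H]
    [Module k H] [FiniteDimensional k H] (e : H ≃ₗ[k] (X →ₗ[R] T)) (f : H →ₗ[k] T) :
    ∃ x, ∀ h, e h x = f h := by
  let b := Module.finBasis k H
  have hli : LinearIndependent k fun j ↦ e (b j) :=
    b.linearIndependent.map' e.toLinearMap e.ker
  obtain ⟨x, hx⟩ := surjective_pi_of_linearIndependent hT hli fun j ↦ f (b j)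
  refine ⟨x, fun h ↦ ?_⟩
  let ev : H →ₗ[k] T :=
    { toFun := fun h ↦ e h x, map_add' := by simp, map_smul' := by simp }
  have : ev = f := b.ext fun j ↦ congrFun hx j
  exact LinearMap.congr_fun this h

/-- Injective because `M` is simple over `Γ` and the map is nonzero; surjective by density over `R`.
-/
theorem bijective_eval {Γ M : Type*} [Ring Γ] [AddCommGroup M] [Module R M] [Module Γ M]
    [IsSimpleModule Γ M] [IsSimpleModule R T]
    (hT : Function.Surjective (algebraMap k (Module.End R T))) {H : Type*} [AddCommGroup H]
    [Module k H] [FiniteDimensional k H] (e : H ≃ₗ[k] (M →ₗ[R] T)) [Module Γ (H →ₗ[k] T)]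
    (ev : M →ₗ[Γ] (H →ₗ[k] T)) (hev : ∀ m h, ev m h = e h m) (π : M →ₗ[R] T) (hπ : π ≠ 0) :
    Function.Bijective ev := by
  constructor
  · refine LinearMap.ker_eq_bot.1 ((eq_bot_or_eq_top _).resolve_right fun h ↦ hπ ?_)
    ext m
    have hm : ev m = 0 := LinearMap.mem_ker.1 (h ▸ Submodule.mem_top)
    have := hev m (e.symm π)
    rw [hm, e.apply_symm_apply] at this
    exact this.symm
  · intro f
    obtain ⟨x, hx⟩ := exists_forall_apply_eq hT e f
    exact ⟨x, by ext h; rw [hev, hx]⟩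

/-- The quotient is taken in the form `R ⧸ I` to lie in the universe of `R`, as
`IsSplittingFieldFor` requires. -/
theorem exists_simple_quotient (R : Type v) [Ring R] (M : Type*) [AddCommGroup M] [Module R M]
    [Module.Finite R M] [Nontrivial M] :
    ∃ I : Ideal R, IsSimpleModule R (R ⧸ I) ∧ ∃ π : M →ₗ[R] R ⧸ I, π ≠ 0 := by
  obtain ⟨N, hN, -⟩ := (eq_top_or_exists_le_coatom (⊥ : Submodule R M)).resolve_left bot_ne_top
  have hs : IsSimpleModule R (M ⧸ N) := isSimpleModule_iff_isCoatom.2 hN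
  obtain ⟨I, _, ⟨e⟩⟩ := isSimpleModule_iff_quot_maximal.1 hs
  refine ⟨I, IsSimpleModule.congr e.symm, e.toLinearMap ∘ₗ N.mkQ, fun h ↦ ?_⟩
  refine hN.1 (eq_top_iff.2 fun x _ ↦ ?_)
  have : e (N.mkQ x) = 0 := LinearMap.congr_fun h x
  rw [LinearEquiv.map_eq_zero_iff] at this
  exact (Submodule.Quotient.mk_eq_zero N).1 this

end Density

/-! ### Transposition of `Hom_k(U, W)`. -/

section Transpose

open MulOpposite

variable {k : Type u} {A : Type v} {B : Type w} [Field k] [Ring A] [Algebra k A] [Ring B]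
  [Algebra k B] {U W V N : Type*} [AddCommGroup U] [Module k U] [Module Aᵐᵒᵖ U]
  [IsScalarTower k Aᵐᵒᵖ U] [AddCommGroup W] [Module k W] [Module B W] [IsScalarTower k B W]
  [AddCommGroup V] [Module k V] [Module A V] [IsScalarTower k A V]
  [AddCommGroup N] [Module k N] [Module Bᵐᵒᵖ N] [IsScalarTower k Bᵐᵒᵖ N]
  [FiniteDimensional k U] [FiniteDimensional k W]
  (e₁ : V ≃ₗ[k] Module.Dual k U) (he₁ : ∀ (a : A) v u, e₁ (a • v) u = e₁ v (op a • u))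
  (e₂ : N ≃ₗ[k] Module.Dual k W) (he₂ : ∀ (b : B) n x, e₂ (op b • n) x = e₂ n (b • x))

include he₁ he₂ in
/-- Transposition identifies `Hom_k(U, W)` with `Hom_k(D W, D U)`. -/
theorem exists_transposeEquiv :
    Nonempty ((U →ₗ[k] W) ≃ₗ[A ⊗[k] B] (N →ₗ[k] V)) := by
  let F : (U →ₗ[k] W) →ₗ[k] (N →ₗ[k] V) :=
    { toFun := fun f ↦ e₁.symm.toLinearMap ∘ₗ f.dualMap ∘ₗ e₂.toLinearMap
      map_add' := fun f g ↦ by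
        ext n
        apply e₁.injective
        ext u
        simp
      map_smul' := fun c f ↦ by
        ext n
        apply e₁.injective
        ext u
        simp }
  have hF (f : U →ₗ[k] W) (n : N) (u : U) : e₁ (F f n) u = e₂ n (f u) := by simp [F]
  have hinj : Function.Injective F := by
    intro f g hfg
    ext u
    rw [← sub_eq_zero, ← Module.forall_dual_apply_eq_zero_iff k]
    intro ξ
    obtain ⟨n, rfl⟩ := e₂.surjective ξ
    rw [map_sub, ← hF, ← hF, hfg, sub_self]
  have : FiniteDimensional k N := Module.Finite.equiv e₂.symm
  have : FiniteDimensional k V := Module.Finite.equiv e₁.symm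
  have hsurj : Function.Surjective F := by
    refine (LinearMap.injective_iff_surjective_of_finrank_eq_finrank ?_).1 hinj
    rw [Module.finrank_linearMap, Module.finrank_linearMap, e₁.finrank_eq, e₂.finrank_eq,
      Subspace.dual_finrank_eq, Subspace.dual_finrank_eq, mul_comm]
  let G : (U →ₗ[k] W) →ₗ[A ⊗[k] B] (N →ₗ[k] V) :=
    tensorLinear k F.toAddMonoidHom
      (fun a f ↦ by
        ext n
        apply e₁.injective
        ext u
        change e₁ (F (a • f) n) u = e₁ (a • F f n) u
        rw [hF, he₁, hF]
        rfl)
      (fun b f ↦ by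
        ext n
        apply e₁.injective
        ext u
        change e₁ (F (b • f) n) u = e₁ (F f (op b • n)) u
        rw [hF, hF, he₂]
        rfl)
  exact ⟨LinearEquiv.ofBijective G ⟨hinj, hsurj⟩⟩

end Transpose

/-! ### Acyclicity for simple coefficients, and part (2). -/

section Main

theorem finiteDimensional_linearMap (k R M N : Type*) [Field k] [Ring R] [Algebra k R]
    [AddCommGroup M] [Module k M] [Module R M] [IsScalarTower k R M] [AddCommGroup N] [Module k N]
    [Module R N] [IsScalarTower k R N] [FiniteDimensional k M] [FiniteDimensional k N] :
    FiniteDimensional k (M →ₗ[R] N) :=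
  Module.Finite.of_injective (LinearMap.restrictScalarsₗ k R M N k)
    (LinearMap.restrictScalars_injective k)

open MulOpposite

variable {k : Type u} {A : Type v} {B : Type w} [Field k] [Ring A] [Algebra k A] [Ring B]
  [Algebra k B] [FiniteDimensional k A] [FiniteDimensional k B]

section Complex

variable {P : ℤ → Type w₁} [∀ i, AddCommGroup (P i)] [∀ i, Module (A ⊗[k] B) (P i)]
  {d : ∀ i, P i →ₗ[A ⊗[k] B] P (i + 1)}
  [∀ i, Module k (P i)] [∀ i, Module A (P i)] [∀ i, Module B (P i)]
  [∀ i, IsScalarTower k A (P i)] [∀ i, IsScalarTower k B (P i)] [∀ i, IsTensorModule k A B (P i)]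
  [∀ i, IsScalarTower k (A ⊗[k] B) (P i)]
  [∀ i, Module.Projective (A ⊗[k] B) (P i)] [∀ i, Module.Finite (A ⊗[k] B) (P i)]
  (hd : ∀ i, Function.Exact (d i) (d (i + 1))) (h : HomExact d (A ⊗[k] B))
  (hA : IsGorenstein A) (hAf : IsCMFree A) (hBf : IsCMFree B)

include hd h hA hBf in
theorem homExact_toRight_of_isCMFree (W : Type*) [AddCommGroup W] [Module B W] :
    HomExact (fun i ↦ toRight (d i)) W := by
  have hB := homExact_toRight_of_isGorenstein hd h hA
  have hproj (i : ℤ) : Module.Projective B (P i) := projective_right_of_projective k A B (P i)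
  have hfin (i : ℤ) : Module.Finite B (P i) := by
    have : Module.Finite k (P i) := Module.Finite.trans (A ⊗[k] B) (P i)
    exact Module.Finite.of_restrictScalars_finite k B (P i)
  have hd' (i : ℤ) : Function.Exact (toRight (d i)) (toRight (d (i + 1))) := hd i
  exact homExact_of_projective_ker hd' (hBf.projective_ker hd' hB) W

open CategoryTheory in
include hd h hA hAf hBf in
-- By adjunction the question concerns `Hom_A(N ⊗_B P, V)`, and `N ⊗_B P` is a complete resolution
-- over the CM-free algebra `A`.
theorem homExact_hom_right (N V : Type*) [AddCommGroup N] [Module k N] [Module Bᵐᵒᵖ N]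
    [IsScalarTower k Bᵐᵒᵖ N] [FiniteDimensional k N] [AddCommGroup V] [Module k V] [Module A V]
    [IsScalarTower k A V] : HomExact d (N →ₗ[k] V) := by
  have hex := balancedMap_exact N hd fun W _ _ ↦ homExact_toRight_of_isCMFree hd h hA hBf W
  have hproj (i : ℤ) := projective_balancedTensor k A B (P i) N
  have hfin (i : ℤ) := finite_balancedTensor k A B (P i) N
  obtain ⟨n, hn⟩ := (injectiveDimension_ne_top_iff _).1 hA.1.ne
  have hFA : HomExact (fun i ↦ balancedMap N (d i)) A :=
    homExact_of_hasInjectiveDimensionLT hex n (ModuleCat.of A A) hn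
  exact homExact_hom_of_homExact_balancedMap
    (homExact_of_projective_ker hex (hAf.projective_ker hex hFA) V)

include hd h hA hAf hBf in
theorem homExact_hom_left (U W : Type*) [AddCommGroup U] [Module k U] [Module Aᵐᵒᵖ U]
    [IsScalarTower k Aᵐᵒᵖ U] [FiniteDimensional k U] [AddCommGroup W] [Module k W] [Module B W]
    [IsScalarTower k B W] [FiniteDimensional k W] : HomExact d (U →ₗ[k] W) := by
  obtain ⟨e⟩ := exists_transposeEquiv (A := A) (B := B) (U := U) (W := W) (V := U →ₗ[k] k)
    (N := W →ₗ[k] k) (.refl k _) (fun _ _ _ ↦ rfl) (.refl k _) (fun _ _ _ ↦ rfl)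
  exact (homExact_hom_right hd h hA hAf hBf (W →ₗ[k] k) (U →ₗ[k] k)).of_equiv e

include hd h hA hAf hBf in
-- With `S` a simple quotient of `M` over the factor split by `k`, evaluation identifies `M` with
-- `Hom_k(Hom(M, S), S)`, the inner Hom being over that factor.
theorem homExact_of_isSimpleModule
    (hs : IsSplittingFieldFor k A ∨ IsSplittingFieldFor k B)
    (M : Type*) [AddCommGroup M] [Module k M] [Module A M] [Module B M] [IsScalarTower k A M]
    [IsScalarTower k B M] [Module (A ⊗[k] B) M] [IsTensorModule k A B M]
    [IsScalarTower k (A ⊗[k] B) M] [IsSimpleModule (A ⊗[k] B) M] : HomExact d M := by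
  have : Nontrivial M := IsSimpleModule.nontrivial (A ⊗[k] B) M
  have : Module.Finite k M := Module.Finite.trans (A ⊗[k] B) M
  have hcomm : SMulCommClass A B M := ⟨smul_comm_of_isTensorModule k⟩
  have hcomm' : SMulCommClass B A M := SMulCommClass.symm ..
  rcases hs with hs | hs
  · have : Module.Finite A M := Module.Finite.of_restrictScalars_finite k A M
    obtain ⟨I, hI, π, hπ⟩ := exists_simple_quotient A M
    have hf := finiteDimensional_linearMap k A M (A ⧸ I)
    let ev : M →ₗ[A ⊗[k] B] ((M →ₗ[A] A ⧸ I) →ₗ[k] A ⧸ I) :=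
      tensorLinear k
        { toFun := fun m ↦
            { toFun := fun f ↦ f m, map_add' := fun _ _ ↦ rfl, map_smul' := fun _ _ ↦ rfl }
          map_zero' := by ext; simp
          map_add' := fun x y ↦ by ext; simp }
        (fun a x ↦ by ext f; exact f.map_smul a x) (fun b x ↦ by ext; rfl)
    have hev := bijective_eval (hs _ hI).2 (.refl k _) ev (fun _ _ ↦ rfl) π hπ
    exact (homExact_hom_right hd h hA hAf hBf _ _).of_equiv (LinearEquiv.ofBijective ev hev)
  · have : Module.Finite B M := Module.Finite.of_restrictScalars_finite k B M
    obtain ⟨I, hI, π, hπ⟩ := exists_simple_quotient B M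
    have hf := finiteDimensional_linearMap k B M (B ⧸ I)
    let ev : M →ₗ[A ⊗[k] B] ((M →ₗ[B] B ⧸ I) →ₗ[k] B ⧸ I) :=
      tensorLinear k
        { toFun := fun m ↦
            { toFun := fun f ↦ f m, map_add' := fun _ _ ↦ rfl, map_smul' := fun _ _ ↦ rfl }
          map_zero' := by ext; simp
          map_add' := fun x y ↦ by ext; simp }
        (fun a x ↦ by ext; rfl) (fun b x ↦ by ext f; exact f.map_smul b x)
    have hev := bijective_eval (hs _ hI).2 (.refl k _) ev (fun _ _ ↦ rfl) π hπ
    exact (homExact_hom_left hd h hA hAf hBf _ _).of_equiv (LinearEquiv.ofBijective ev hev)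

omit [FiniteDimensional k A] [FiniteDimensional k B] in
variable (k A B) in
theorem exists_restrictedModules (M : Type*) [AddCommGroup M] [Module (A ⊗[k] B) M] :
    ∃ (_ : Module k M) (_ : Module A M) (_ : Module B M), IsScalarTower k A M ∧
      IsScalarTower k B M ∧ IsTensorModule k A B M ∧ IsScalarTower k (A ⊗[k] B) M := by
  let iA : A →ₐ[k] A ⊗[k] B := Algebra.TensorProduct.includeLeft
  let iB : B →ₐ[k] A ⊗[k] B := Algebra.TensorProduct.includeRight
  let _ : Module k M := Module.compHom M (algebraMap k (A ⊗[k] B))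
  let _ : Module A M := Module.compHom M iA.toRingHom
  let _ : Module B M := Module.compHom M iB.toRingHom
  refine ⟨inferInstance, inferInstance, inferInstance, ⟨fun c a m ↦ ?_⟩, ⟨fun c a m ↦ ?_⟩,
    ⟨fun a b m ↦ ?_⟩, ⟨fun c a m ↦ ?_⟩⟩
  · change iA (c • a) • m = algebraMap k (A ⊗[k] B) c • iA a • m
    rw [map_smul, Algebra.smul_def, mul_smul]
  · change iB (c • a) • m = algebraMap k (A ⊗[k] B) c • iB a • m
    rw [map_smul, Algebra.smul_def, mul_smul]
  · change (a ⊗ₜ[k] b) • m = iA a • iB b • m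
    rw [smul_smul]
    simp [iA, iB]
  · change (c • a) • m = algebraMap k (A ⊗[k] B) c • a • m
    rw [Algebra.smul_def, mul_smul]

end Complex

theorem IsCMFree.tensorProduct_of_isGorenstein_left (hA : IsGorenstein A)
    (hs : IsSplittingFieldFor k A ∨ IsSplittingFieldFor k B) (hAf : IsCMFree A)
    (hBf : IsCMFree B) : IsCMFree (A ⊗[k] B) := by
  refine isCMFree_of_projective_ker fun P d hfin hproj hd h ↦ ?_
  choose _ _ _ _ _ _ _ using fun i ↦ exists_restrictedModules k A B (P i)
  -- Induction on a composition series; the kernel itself has finite length, so it may serve as `M`.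
  have key (M : Type (max v w)) [AddCommGroup M] [Module (A ⊗[k] B) M]
      (hM : IsFiniteLength (A ⊗[k] B) M) : HomExact d M := by
    induction hM with
    | of_subsingleton => exact homExact_of_subsingleton
    | @of_simple_quotient M _ _ N _ _ ih =>
      obtain ⟨_, _, _, _, _, _, _⟩ := exists_restrictedModules k A B (M ⧸ N)
      have hQ := homExact_of_isSimpleModule hd h hA hAf hBf hs (M ⧸ N)
      exact HomExact.of_left_of_right hd N.subtype_injective
        (LinearMap.exact_subtype_mkQ N) N.mkQ_surjective ih hQ
  have : IsArtinianRing (A ⊗[k] B) := IsArtinianRing.of_finite k _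
  exact projective_ker_of_homExact hd 1
    (key _ (isFiniteLength_iff_isNoetherian_isArtinian.2 ⟨inferInstance, inferInstance⟩))

end Main

end FinDimAlg

theorem mainTheorem9 {k : Type*} {A : Type*} {B : Type*} [Field k]
    [Ring A] [Algebra k A] [FiniteDimensional k A] [Nontrivial A]
    [Ring B] [Algebra k B] [FiniteDimensional k B] [Nontrivial B] :
    (FinDimAlg.IsCMFree (A ⊗[k] B) → FinDimAlg.IsCMFree A ∧ FinDimAlg.IsCMFree B) ∧
    (FinDimAlg.IsSplittingFieldFor k A ∨ FinDimAlg.IsSplittingFieldFor k B →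
      FinDimAlg.IsGorenstein A ∨ FinDimAlg.IsGorenstein B →
      (FinDimAlg.IsCMFree (A ⊗[k] B) ↔ FinDimAlg.IsCMFree A ∧ FinDimAlg.IsCMFree B)) := by
  have hdown (h : FinDimAlg.IsCMFree (A ⊗[k] B)) :
      FinDimAlg.IsCMFree A ∧ FinDimAlg.IsCMFree B :=
    ⟨h.left_of_tensorProduct,
      (h.of_ringEquiv (Algebra.TensorProduct.comm k A B).toRingEquiv).left_of_tensorProduct⟩
  refine ⟨hdown, fun hs hG ↦ ⟨hdown, fun ⟨hA, hB⟩ ↦ ?_⟩⟩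
  rcases hG with hG | hG
  · exact FinDimAlg.IsCMFree.tensorProduct_of_isGorenstein_left hG hs hA hB
  · exact (FinDimAlg.IsCMFree.tensorProduct_of_isGorenstein_left hG hs.symm hB hA).of_ringEquiv
      (Algebra.TensorProduct.comm k B A).toRingEquiv
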